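/- Let $H_k=\sum_{m=1}^k 1/m$ ($H_0=0$), let $\gamma$ be Euler's constant, and let $$J_0(x)=\sum_{k\ge0}\frac{(-x^2/4)^k}{(k!)^2},\qquad Y_0(x)=\frac2\pi\Bigl[J_0(x)\bigl(\ln\tfrac x2+\gamma\bigr)-\sum_{k\ge1}\frac{(-x^2/4)^k}{(k!)^2}H_k\Bigr]$$ be the Bessel functions of order zero (principal branch of the logarithm). For $\kappa\in\mathbb C$ let $\Phi_\kappa,\Psi_\kappa:\mathbb Z_{\ge0}\to\mathbb C$ be the solutions $\lambda$ of the difference equation $$-(n+1)(\lambda_{n+1}-\lambda_n)+n(\lambda_n-\lambda_{n-1})=\kappa\lambda_n\qquad(n\ge1)$$ with initial values $\Phi_\kappa(0)=1$, $\Phi_\kappa(1)=1-\kappa$ and $\Psi_\kappa(0)=0$, $\Psi_\kappa(1)=1$. Put $$F(\kappa)=e^{\kappa}\sum_{s\ge0}\frac{(-\kappa)^s}{s!}H_s-\gamma-\ln\kappa,\qquad x=x(n,\kappa)=\sqrt{4n\kappa}$$ (principal branches). Then for every fixed $\kappa$ with $\operatorname{Re}\kappa>0$, as $n\to\infty$,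 $$\Phi_\kappa(n)= e^{\kappa/2}J_0(x)+o\bigl(|J_0(x)|+|Y_0(x)|\bigr),$$ $$\Psi_\kappa(n)=\pi e^{-\kappa/2}Y_0(x)+e^{-\kappa/2}F(\kappa)J_0(x)+o\bigl(|J_0(x)|+|Y_0(x)|\bigr).$$ If moreover $\operatorname{Im}\kappa\neq0$, then in both cases the left-hand side is asymptotically equivalent to the main term on the right: $\Phi_\kappa(n)\sim e^{\kappa/2}J_0(x)$ and $\Psi_\kappa(n)\sim \pi e^{-\kappa/2}Y_0(x)+e^{-\kappa/2}F(\kappa)J_0(x)$, that is, the quotient of the two sides tends to $1$. -/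

import Mathlib

noncomputable section

namespace NCSoliton

/-- The second-order difference operator
`(A l)_n = -(n+1) (l_{n+1} - l_n) + n (l_n - l_{n-1})` on complex sequences. (At `n = 0` the last
summand is multiplied by zero; the eigenvalue equation below is only imposed for `n ≥ 1`.) -/
def opA (l : ℕ → ℂ) (n : ℕ) : ℂ :=
  -((n : ℂ) + 1) * (l (n + 1) - l n) + (n : ℂ) * (l n - l (n - 1))

/-- `l` solves the finite difference equation `(A l)_n = κ l_n` for all `n ≥ 1`. -/
def IsEigensequence (κ : ℂ) (l : ℕ → ℂ) : Prop :=
  ∀ n : ℕ, 1 ≤ n → opA l n = κ * l n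

/-- The solution of `(A l)_n = κ l_n`, `n ≥ 1`, with initial values `l_0 = a`, `l_1 = b`
(see `eigensolution_spec` and `eigensolution_unique`). -/
def eigensolution (κ a b : ℂ) : ℕ → ℂ
  | 0 => a
  | 1 => b
  | n + 2 => eigensolution κ a b (n + 1) +
      (((n : ℂ) + 1) * (eigensolution κ a b (n + 1) - eigensolution κ a b n)
        - κ * eigensolution κ a b (n + 1)) / ((n : ℂ) + 2)

theorem eigensolution_spec (κ a b : ℂ) :
    IsEigensequence κ (eigensolution κ a b) ∧
      eigensolution κ a b 0 = a ∧ eigensolution κ a b 1 = b := by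
  refine ⟨?_, by simp [eigensolution], by simp [eigensolution]⟩
  intro n hn
  obtain ⟨m, rfl⟩ : ∃ m, n = m + 1 := ⟨n - 1, by omega⟩
  have h2 : (m : ℂ) + 2 ≠ 0 := by exact_mod_cast (by omega : m + 2 ≠ 0)
  have h3 : (m : ℂ) + 1 + 1 ≠ 0 := by exact_mod_cast (by omega : m + 1 + 1 ≠ 0)
  simp only [opA, eigensolution, Nat.add_sub_cancel]
  push_cast
  field_simp
  ring

theorem eigensolution_unique {κ : ℂ} {l : ℕ → ℂ} (h : IsEigensequence κ l) :
    l = eigensolution κ (l 0) (l 1) := by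
  funext n
  induction n using Nat.twoStepInduction with
  | zero => simp [eigensolution]
  | one => simp [eigensolution]
  | more m ih1 ih2 =>
    have h2 : (m : ℂ) + 2 ≠ 0 := by exact_mod_cast (by omega : m + 2 ≠ 0)
    have e := h (m + 1) (by omega)
    simp only [opA, Nat.add_sub_cancel] at e
    push_cast at e
    rw [eigensolution, ← ih1, ← ih2]
    field_simp
    linear_combination -e

/-- `Φ_κ`: the solution of `A l = κ l` with `Φ_κ(0) = 1`, `Φ_κ(1) = 1 - κ`. -/
def Phi (κ : ℂ) : ℕ → ℂ := eigensolution κ 1 (1 - κ)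

/-- `Ψ_κ`: the solution of `A l = κ l` with `Ψ_κ(0) = 0`, `Ψ_κ(1) = 1`. -/
def Psi (κ : ℂ) : ℕ → ℂ := eigensolution κ 0 1

/-- The Bessel function of the first kind of order zero,
`J₀(x) = ∑_{k ≥ 0} (-x²/4)^k / (k!)²`. -/
def besselJ0 (x : ℂ) : ℂ :=
  ∑' k : ℕ, (-x ^ 2 / 4) ^ k / ((k.factorial : ℂ) ^ 2)

/-- The Bessel function of the second kind of order zero (principal branch),
`Y₀(x) = (2/π) [J₀(x) (ln (x/2) + γ) - ∑_{k ≥ 1} (-x²/4)^k / (k!)² H_k]`; the summand `k = 0`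
vanishes because `H_0 = 0`. -/
def besselY0 (x : ℂ) : ℂ :=
  (2 / (Real.pi : ℂ)) *
    (besselJ0 x * (Complex.log (x / 2) + (Real.eulerMascheroniConstant : ℂ))
      - ∑' k : ℕ, (-x ^ 2 / 4) ^ k / ((k.factorial : ℂ) ^ 2) * ((harmonic k : ℚ) : ℂ))

/-- `F(κ) = e^κ ∑_{s ≥ 0} (-κ)^s / s! H_s - γ - ln κ`. -/
def F (κ : ℂ) : ℂ :=
  Complex.exp κ * (∑' s : ℕ, (-κ) ^ s / (s.factorial : ℂ) * ((harmonic s : ℚ) : ℂ))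
    - (Real.eulerMascheroniConstant : ℂ) - Complex.log κ

/-- `x(n, κ) = √(4 n κ)`, principal branch: for `Re κ > 0` the signs of the imaginary parts of
`x(n, κ)` and `κ` agree, and `x(n, κ)` has non-negative real part. -/
def besselArg (κ : ℂ) (n : ℕ) : ℂ := Complex.sqrt (4 * (n : ℂ) * κ)

/-- The comparison function `e^{κ/2} J₀(x(n, κ))`. -/
def PhiAsym (κ : ℂ) (n : ℕ) : ℂ := Complex.exp (κ / 2) * besselJ0 (besselArg κ n)

/-- The comparison function `π e^{-κ/2} Y₀(x(n, κ)) + e^{-κ/2} F(κ) J₀(x(n, κ))`. -/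
def PsiAsym (κ : ℂ) (n : ℕ) : ℂ :=
  (Real.pi : ℂ) * Complex.exp (-κ / 2) * besselY0 (besselArg κ n)
    + Complex.exp (-κ / 2) * F κ * besselJ0 (besselArg κ n)

/-- The common size of the two Bessel functions at `x(n, κ)`. -/
def besselSize (κ : ℂ) (n : ℕ) : ℝ := ‖besselJ0 (besselArg κ n)‖ + ‖besselY0 (besselArg κ n)‖

end NCSoliton

end

/-! Everything is reduced to one function, the modified Bessel function `K₀` on the slit plane, and
to its mean against the Gamma density, `gammaMean z n = (1/n!) ∫ e^{-t} t^n K₀(z √t) dt`. This mean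
is computed in two ways.

Exactly: expanding `K₀` at zero and integrating term by term (`gammaMean_eq_momentSum`) gives a
combination of `momentSum` and `logMomentSum` at `z²/4`. Both solve the difference equation with `κ
= -z²/4`. For `z = ∓i√(4κ)` the two means differ only through the branch of the logarithm, hence are
independent solutions, and `Phi` and `Psi` are explicit combinations of them (`Phi_eq_hankelMean`,
`Psi_eq_hankelMean`).

Asymptotically: with `t = (√n + s)²` the Gamma density becomes a Gaussian `e^{-2s²}` in `s`, while
`K₀(z(√n + s))` behaves like `e^{-zs} K₀(z√n)`. Laplace's method gives `gammaMean z n ~ e^{z²/8}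
K₀(z√n)` (`tendsto_gammaMean_div`), and `e^{z²/8} = e^{-κ/2}`. Since `K₀(∓ix)` is a multiple of the
Hankel function `J₀ ± iY₀`, recombining yields the two little-o statements.

The exact computation needs the series of `K₀`, the asymptotic one its Laplace integral. They agree
(`besselK_eq_besselKSeries`) because both solve the modified Bessel equation and have the same
logarithmic behaviour at zero.

For non-real `κ` one Hankel function is exponentially larger than the other, so equivalence holds
once its coefficient is nonzero. For `Phi` this is visible. For `Psi`, a vanishing coefficient would
make `Psi` decay, which a Casoratian of `Psi` with its conjugate excludes
(`not_tendsto_natCast_mul_Psi`). -/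

namespace NCSoliton
open Complex Filter Topology MeasureTheory Set

/-! ### Entire power series and the Bessel differential equation -/

/-- The sum of the power series with coefficients `a`. -/
noncomputable def seriesSum (a : ℕ → ℂ) (y : ℂ) : ℂ := ∑' k, a k * y ^ k

/-- The coefficients of the derivative of the power series with coefficients `a`. -/
def derivCoeff (a : ℕ → ℂ) (k : ℕ) : ℂ := (k + 1) * a (k + 1)

/-- The power series with coefficients `a` converges absolutely everywhere. -/
def EntireCoeff (a : ℕ → ℂ) : Prop := ∀ r : ℝ, 0 ≤ r → Summable fun k => ‖a k‖ * r ^ k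

theorem EntireCoeff.summable {a : ℕ → ℂ} (ha : EntireCoeff a) (y : ℂ) :
    Summable fun k => a k * y ^ k :=
  Summable.of_norm (by simpa using ha ‖y‖ (norm_nonneg y))

theorem EntireCoeff.derivCoeff {a : ℕ → ℂ} (ha : EntireCoeff a) : EntireCoeff (derivCoeff a) := by
  intro r hr
  have h := (summable_nat_add_iff 1).2 (ha (2 * r + 2) (by positivity))
  refine Summable.of_nonneg_of_le (fun k => by positivity) (fun k => ?_) h
  have h1 : ‖((k : ℂ) + 1)‖ = (k : ℝ) + 1 := by
    rw [← Nat.cast_succ, Complex.norm_natCast]; push_cast; ring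
  have h2 : ((k : ℝ) + 1) ≤ 2 ^ (k + 1) := by
    exact_mod_cast (Nat.lt_two_pow_self (n := k + 1)).le
  have h3 : r ^ k ≤ (r + 1) ^ (k + 1) := by
    calc r ^ k ≤ (r + 1) ^ k := by gcongr; linarith
      _ ≤ (r + 1) ^ (k + 1) := pow_le_pow_right₀ (by linarith) (Nat.le_succ k)
  rw [NCSoliton.derivCoeff, norm_mul, h1]
  calc ((k : ℝ) + 1) * ‖a (k + 1)‖ * r ^ k
      ≤ 2 ^ (k + 1) * ‖a (k + 1)‖ * (r + 1) ^ (k + 1) := by gcongr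
    _ = ‖a (k + 1)‖ * (2 * r + 2) ^ (k + 1) := by
      rw [show 2 * r + 2 = 2 * (r + 1) by ring, mul_pow]; ring

theorem EntireCoeff.hasDerivAt {a : ℕ → ℂ} (ha : EntireCoeff a) (y : ℂ) :
    HasDerivAt (seriesSum a) (seriesSum (NCSoliton.derivCoeff a) y) y := by
  have hu : Summable fun k : ℕ => ‖a k‖ * (k * (‖y‖ + 1) ^ (k - 1)) := by
    rw [← summable_nat_add_iff 1]
    refine (ha.derivCoeff (‖y‖ + 1) (by positivity)).congr fun k => ?_
    rw [NCSoliton.derivCoeff, norm_mul, ← Nat.cast_succ, Complex.norm_natCast]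
    simp; ring
  have h := hasDerivAt_tsum_of_isPreconnected (g := fun k z => a k * z ^ k)
    (g' := fun k z => a k * (k * z ^ (k - 1))) hu Metric.isOpen_ball
    (convex_ball (0 : ℂ) (‖y‖ + 1)).isPreconnected
    (fun k z _ => (hasDerivAt_pow k z).const_mul (a k))
    (fun k z hz => by
      have : ‖z‖ ≤ ‖y‖ + 1 := by simpa using (mem_ball_zero_iff.1 hz).le
      simp only [norm_mul, norm_pow, Complex.norm_natCast]
      gcongr)
    (by simp) (ha.summable y) (show y ∈ Metric.ball 0 _ by simp)
  refine h.congr_deriv ?_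
  rw [Summable.tsum_eq_zero_add]
  · simp only [Nat.cast_zero, zero_mul, mul_zero, zero_add, seriesSum, NCSoliton.derivCoeff]
    refine tsum_congr fun k => ?_
    push_cast; ring_nf
  · refine Summable.of_norm_bounded hu fun k => ?_
    simp only [norm_mul, norm_pow, Complex.norm_natCast]
    gcongr
    linarith

/-- If `f = ∑ a_k y^k`, then `y f'' + f' = ∑ (k+1)² a_{k+1} y^k`. -/
theorem EntireCoeff.euler_identity {a : ℕ → ℂ} (ha : EntireCoeff a) (y : ℂ) :
    y * seriesSum (NCSoliton.derivCoeff (NCSoliton.derivCoeff a)) y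
      + seriesSum (NCSoliton.derivCoeff a) y
      = seriesSum (fun k => ((k : ℂ) + 1) ^ 2 * a (k + 1)) y := by
  have h1 := ha.derivCoeff.summable y
  have h2 := ha.derivCoeff.derivCoeff.summable y
  have h3 : y * seriesSum (NCSoliton.derivCoeff (NCSoliton.derivCoeff a)) y
      = ∑' k : ℕ, (k : ℂ) * NCSoliton.derivCoeff a k * y ^ k := by
    rw [Summable.tsum_eq_zero_add, seriesSum, ← tsum_mul_left]
    · simp only [Nat.cast_zero, zero_mul, zero_add]
      refine tsum_congr fun k => ?_
      rw [NCSoliton.derivCoeff]; push_cast; ring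
    · rw [← summable_nat_add_iff 1]
      refine (h2.mul_left y).congr fun k => ?_
      rw [NCSoliton.derivCoeff]; push_cast; ring
  have h4 : Summable fun k : ℕ => (k : ℂ) * NCSoliton.derivCoeff a k * y ^ k := by
    rw [← summable_nat_add_iff 1]
    refine (h2.mul_left y).congr fun k => ?_
    rw [NCSoliton.derivCoeff]; push_cast; ring
  rw [h3, seriesSum, ← h4.tsum_add h1, seriesSum]
  refine tsum_congr fun k => ?_
  simp only [NCSoliton.derivCoeff]; ring

/-- Coefficients of `∑ y^k / k!²`. -/
noncomputable def besselCoeff (k : ℕ) : ℂ := 1 / (k.factorial : ℂ) ^ 2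

/-- Coefficients of `∑ H_k y^k / k!²`. -/
noncomputable def besselHarmonicCoeff (k : ℕ) : ℂ :=
  ((harmonic k : ℚ) : ℂ) / (k.factorial : ℂ) ^ 2

/-- A crude exponential bound suffices: it is absorbed into the base of the exponential series used
as majorant. -/
theorem harmonic_le_two_pow (k : ℕ) : ((harmonic k : ℚ) : ℝ) ≤ 2 ^ k := by
  have h : ∀ k : ℕ, harmonic k ≤ k := by
    intro k
    induction k with
    | zero => simp
    | succ k ih =>
      rw [harmonic_succ]
      have : ((k + 1 : ℕ) : ℚ)⁻¹ ≤ 1 := inv_le_one_of_one_le₀ (by exact_mod_cast Nat.succ_pos k)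
      push_cast at this ⊢; linarith
  calc ((harmonic k : ℚ) : ℝ) ≤ k := by exact_mod_cast h k
    _ ≤ 2 ^ k := by exact_mod_cast (Nat.lt_two_pow_self (n := k)).le

theorem harmonic_nonneg (k : ℕ) : 0 ≤ ((harmonic k : ℚ) : ℝ) := by
  have : (0 : ℚ) ≤ harmonic k := Finset.sum_nonneg fun i _ => by positivity
  exact_mod_cast this

theorem norm_harmonic (k : ℕ) : ‖((harmonic k : ℚ) : ℂ)‖ = ((harmonic k : ℚ) : ℝ) := by
  rw [← Complex.ofReal_ratCast, Complex.norm_real, Real.norm_of_nonneg (harmonic_nonneg k)]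

theorem entireCoeff_of_norm_le {a : ℕ → ℂ} {C b : ℝ}
    (h : ∀ k, ‖a k‖ ≤ C * b ^ k / k.factorial) : EntireCoeff a := by
  intro r hr
  refine Summable.of_nonneg_of_le (fun k => by positivity) (fun k => ?_)
    ((Real.summable_pow_div_factorial (b * r)).mul_left C)
  calc ‖a k‖ * r ^ k ≤ C * b ^ k / k.factorial * r ^ k := by gcongr; exact h k
    _ = C * ((b * r) ^ k / k.factorial) := by rw [mul_pow]; ring

theorem entireCoeff_besselCoeff : EntireCoeff besselCoeff := by
  refine entireCoeff_of_norm_le (C := 1) (b := 1) fun k => ?_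
  have : (1 : ℝ) ≤ k.factorial := by exact_mod_cast k.factorial_pos
  simp only [besselCoeff, norm_div, norm_one, norm_pow, Complex.norm_natCast, one_pow, mul_one]
  gcongr
  nlinarith

theorem entireCoeff_besselHarmonicCoeff : EntireCoeff besselHarmonicCoeff := by
  refine entireCoeff_of_norm_le (C := 1) (b := 2) fun k => ?_
  have : (1 : ℝ) ≤ k.factorial := by exact_mod_cast k.factorial_pos
  simp only [besselHarmonicCoeff, norm_div, norm_pow, Complex.norm_natCast, norm_harmonic, one_mul]
  gcongr
  · exact harmonic_le_two_pow k
  · nlinarith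

theorem harmonic_succ_cast (k : ℕ) :
    ((harmonic (k + 1) : ℚ) : ℂ) = ((harmonic k : ℚ) : ℂ) + 1 / ((k : ℂ) + 1) := by
  rw [harmonic_succ]; push_cast; ring

theorem factorial_succ_cast (k : ℕ) :
    ((k + 1).factorial : ℂ) = ((k : ℂ) + 1) * (k.factorial : ℂ) := by
  rw [Nat.factorial_succ]; push_cast; ring

theorem factorial_cast_ne_zero (k : ℕ) : (k.factorial : ℂ) ≠ 0 := by
  exact_mod_cast k.factorial_ne_zero

theorem natCast_succ_ne_zero (k : ℕ) : (k : ℂ) + 1 ≠ 0 := by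
  exact_mod_cast Nat.succ_ne_zero k

theorem besselCoeff_ode (y : ℂ) :
    y * seriesSum (derivCoeff (derivCoeff besselCoeff)) y + seriesSum (derivCoeff besselCoeff) y
      = seriesSum besselCoeff y := by
  rw [entireCoeff_besselCoeff.euler_identity]
  congr 1; funext k
  have := factorial_cast_ne_zero k
  have := natCast_succ_ne_zero k
  simp only [besselCoeff, factorial_succ_cast]
  field_simp

/-- The increment `H_{k+1} - H_k = 1/(k+1)` produces the inhomogeneous term. It is exactly what the
logarithmic part of `K₀` contributes with opposite sign. -/
theorem besselHarmonicCoeff_ode (y : ℂ) :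
    y * seriesSum (derivCoeff (derivCoeff besselHarmonicCoeff)) y
      + seriesSum (derivCoeff besselHarmonicCoeff) y
      = seriesSum besselHarmonicCoeff y + seriesSum (derivCoeff besselCoeff) y := by
  rw [entireCoeff_besselHarmonicCoeff.euler_identity, seriesSum, seriesSum, seriesSum,
    ← (entireCoeff_besselHarmonicCoeff.summable y).tsum_add
      (entireCoeff_besselCoeff.derivCoeff.summable y)]
  refine tsum_congr fun k => ?_
  have := factorial_cast_ne_zero k
  have := natCast_succ_ne_zero k
  simp only [besselCoeff, besselHarmonicCoeff, derivCoeff, factorial_succ_cast, harmonic_succ_cast]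
  field_simp

/-! ### Gamma integrals, with and without a logarithm -/

/-- `∫₀^∞ e^{-t} t^m log t dt = m! (H_m - γ)`. -/
theorem integral_exp_neg_mul_pow_mul_log (m : ℕ) :
    IntegrableOn (fun t : ℝ => Real.exp (-t) * t ^ m * Real.log t) (Ioi 0) ∧
    ∫ t in Ioi (0 : ℝ), Real.exp (-t) * t ^ m * Real.log t
      = m.factorial * (((harmonic m : ℚ) : ℝ) - Real.eulerMascheroniConstant) := by
  have hs : 0 < ((m : ℂ) + 1).re := by
    simp only [add_re, natCast_re, one_re]; positivity
  have hO : Continuous fun x : ℝ => ((Real.exp (-x) : ℝ) : ℂ) :=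
    continuous_ofReal.comp (Real.continuous_exp.comp continuous_neg)
  have e : ∀ t ∈ Ioi (0 : ℝ), ((t : ℂ) ^ ((m : ℂ) + 1 - 1)) * ((Real.log t : ℂ) * Real.exp (-t))
      = ((Real.exp (-t) * t ^ m * Real.log t : ℝ) : ℂ) := by
    intro t _
    rw [add_sub_cancel_right, cpow_natCast]; push_cast; ring
  have h1 := (mellin_hasDerivAt_of_isBigO_rpow (E := ℂ) (f := fun x : ℝ => ((Real.exp (-x) : ℝ) : ℂ))
    (a := ((m : ℂ) + 1).re + 1) (b := 0) (s := (m : ℂ) + 1)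
    (hO.continuousOn.locallyIntegrableOn measurableSet_Ioi)
    (by
      rw [← Asymptotics.isBigO_norm_left]
      simp_rw [norm_real, Asymptotics.isBigO_norm_left]
      simpa only [neg_one_mul] using (isLittleO_exp_neg_mul_rpow_atTop zero_lt_one _).isBigO)
    (lt_add_one _)
    (by
      simp_rw [neg_zero, Real.rpow_zero]
      refine Asymptotics.isBigO_const_of_tendsto (y := (1 : ℂ)) ?_ one_ne_zero
      have := hO.continuousWithinAt (s := Ioi 0) (x := 0)
      simpa [ContinuousWithinAt] using this) hs).1
  have h2 : IntegrableOn (fun t : ℝ => ((Real.exp (-t) * t ^ m * Real.log t : ℝ) : ℂ)) (Ioi 0) := by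
    refine h1.congr_fun (fun t ht => ?_) measurableSet_Ioi
    rw [← e t ht]; simp [smul_eq_mul]
  -- The integral is the derivative of Gamma at `m + 1`, and Mathlib knows that value in terms of
  -- `H_m` and `γ`.
  have h3 := (hasDerivAt_GammaIntegral hs).unique
    ((Complex.hasDerivAt_Gamma_nat m).congr_of_eventuallyEq (by
      filter_upwards [(continuous_re.isOpen_preimage _ isOpen_Ioi).mem_nhds hs] with z hz
      exact (Complex.Gamma_eq_integral hz).symm))
  rw [setIntegral_congr_fun measurableSet_Ioi e, integral_complex_ofReal] at h3
  refine ⟨by simpa only [RCLike.re_to_complex, ofReal_re] using! h2.re, ?_⟩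
  apply Complex.ofReal_injective
  rw [h3]; push_cast; ring

theorem integral_exp_neg_mul_pow (m : ℕ) :
    IntegrableOn (fun t : ℝ => Real.exp (-t) * t ^ m) (Ioi 0) ∧
    ∫ t in Ioi (0 : ℝ), Real.exp (-t) * t ^ m = m.factorial := by
  have h0 : (0 : ℝ) < (m : ℝ) + 1 := by positivity
  have e : ∀ t : ℝ, Real.exp (-t) * t ^ ((m : ℝ) + 1 - 1) = Real.exp (-t) * t ^ m := by
    intro t; rw [add_sub_cancel_right, Real.rpow_natCast]
  constructor
  · simpa only [e] using Real.GammaIntegral_convergent h0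
  · rw [← Real.Gamma_nat_eq_factorial, Real.Gamma_eq_integral h0]
    simp only [e]

/-! ### The modified Bessel equation and the characterization of `K₀` at zero -/

/-- `(f, g)` with `g = z f'` solves `(z d/dz)² f = z² f` on the slit plane. -/
def IsModifiedBesselPair (f g : ℂ → ℂ) : Prop :=
  ∀ z ∈ slitPlane, HasDerivAt f (g z / z) z ∧ HasDerivAt g (z * f z) z

theorem isPreconnected_slitPlane : IsPreconnected slitPlane :=
  (starConvex_one_slitPlane.isPathConnected one_mem_slitPlane).isConnected.isPreconnected

theorem IsModifiedBesselPair.wronskian_const {f₁ g₁ f₂ g₂ : ℂ → ℂ}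
    (h₁ : IsModifiedBesselPair f₁ g₁) (h₂ : IsModifiedBesselPair f₂ g₂) :
    ∃ c, ∀ z ∈ slitPlane, f₁ z * g₂ z - g₁ z * f₂ z = c := by
  have hd : ∀ z ∈ slitPlane, HasDerivAt (fun z => f₁ z * g₂ z - g₁ z * f₂ z) 0 z := by
    intro z hz
    have hz0 := slitPlane_ne_zero hz
    refine (((h₁ z hz).1.mul (h₂ z hz).2).sub ((h₁ z hz).2.mul (h₂ z hz).1)).congr_deriv ?_
    field_simp; ring
  exact isOpen_slitPlane.exists_is_const_of_deriv_eq_zero isPreconnected_slitPlane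
    (fun z hz => (hd z hz).differentiableAt.differentiableWithinAt) (fun z hz => (hd z hz).deriv)

/-- The modified Bessel function `I₀`. -/
noncomputable def besselI (z : ℂ) : ℂ := seriesSum besselCoeff (z ^ 2 / 4)

/-- `z I₀'(z)`. -/
noncomputable def besselIDeriv (z : ℂ) : ℂ :=
  z ^ 2 / 2 * seriesSum (derivCoeff besselCoeff) (z ^ 2 / 4)

/-- The modified Bessel function `K₀`, by its expansion at zero. -/
noncomputable def besselKSeries (z : ℂ) : ℂ :=
  -(log (z / 2) + Real.eulerMascheroniConstant) * besselI z
    + seriesSum besselHarmonicCoeff (z ^ 2 / 4)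

/-- `z K₀'(z)`. -/
noncomputable def besselKSeriesDeriv (z : ℂ) : ℂ :=
  -besselI z - (log (z / 2) + Real.eulerMascheroniConstant) * besselIDeriv z
    + z ^ 2 / 2 * seriesSum (derivCoeff besselHarmonicCoeff) (z ^ 2 / 4)

theorem EntireCoeff.hasDerivAt_comp_sq {a : ℕ → ℂ} (ha : EntireCoeff a) (z : ℂ) :
    HasDerivAt (fun z => seriesSum a (z ^ 2 / 4)) (z / 2 * seriesSum (NCSoliton.derivCoeff a) (z ^ 2 / 4)) z := by
  have h := (ha.hasDerivAt (z ^ 2 / 4)).comp z ((hasDerivAt_pow 2 z).div_const 4)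
  refine h.congr_deriv ?_
  push_cast; ring

theorem hasDerivAt_besselI (z : ℂ) (hz : z ≠ 0) : HasDerivAt besselI (besselIDeriv z / z) z := by
  refine (entireCoeff_besselCoeff.hasDerivAt_comp_sq z).congr_deriv ?_
  rw [besselIDeriv]; field_simp

theorem hasDerivAt_besselIDeriv (z : ℂ) : HasDerivAt besselIDeriv (z * besselI z) z := by
  refine (((hasDerivAt_pow 2 z).div_const 2).mul
    (entireCoeff_besselCoeff.derivCoeff.hasDerivAt_comp_sq z)).congr_deriv ?_
  have h := besselCoeff_ode (z ^ 2 / 4)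
  rw [besselI, ← h]; push_cast; ring

theorem isModifiedBesselPair_besselI : IsModifiedBesselPair besselI besselIDeriv := fun z hz =>
  ⟨hasDerivAt_besselI z (slitPlane_ne_zero hz), hasDerivAt_besselIDeriv z⟩

theorem half_mem_slitPlane {z : ℂ} (hz : z ∈ slitPlane) : z / 2 ∈ slitPlane := by
  rw [mem_slitPlane_iff] at hz ⊢
  have h1 : (z / 2).re = z.re / 2 := by simp
  have h2 : (z / 2).im = z.im / 2 := by simp
  rw [h1, h2]
  rcases hz with h | h
  · left; linarith
  · right; intro h'; apply h; linarith

theorem hasDerivAt_log_half {z : ℂ} (hz : z ∈ slitPlane) :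
    HasDerivAt (fun z => log (z / 2) + (Real.eulerMascheroniConstant : ℂ)) (1 / z) z := by
  have h := ((hasDerivAt_id z).div_const 2).clog (half_mem_slitPlane hz)
  refine (h.add_const _).congr_deriv ?_
  have := slitPlane_ne_zero hz
  simp only [id]; field_simp

theorem isModifiedBesselPair_besselKSeries :
    IsModifiedBesselPair besselKSeries besselKSeriesDeriv := by
  intro z hz
  have hz0 := slitPlane_ne_zero hz
  have hl := hasDerivAt_log_half hz
  have hi := hasDerivAt_besselI z hz0
  have hi' := hasDerivAt_besselIDeriv z
  constructor
  · refine ((hl.neg.mul hi).add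
      (entireCoeff_besselHarmonicCoeff.hasDerivAt_comp_sq z)).congr_deriv ?_
    simp only [besselKSeriesDeriv, Pi.neg_apply]; field_simp; ring
  · refine ((hi.neg.sub (hl.mul hi')).add (((hasDerivAt_pow 2 z).div_const 2).mul
      (entireCoeff_besselHarmonicCoeff.derivCoeff.hasDerivAt_comp_sq z))).congr_deriv ?_
    have h := besselHarmonicCoeff_ode (z ^ 2 / 4)
    simp only [besselKSeries, besselIDeriv]
    have hz2 : z ^ 2 / 2 * seriesSum (derivCoeff besselCoeff) (z ^ 2 / 4) / z
      = z / 2 * seriesSum (derivCoeff besselCoeff) (z ^ 2 / 4) := by field_simp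
    have hz3 : 1 / z * (z ^ 2 / 2 * seriesSum (derivCoeff besselCoeff) (z ^ 2 / 4))
      = z / 2 * seriesSum (derivCoeff besselCoeff) (z ^ 2 / 4) := by field_simp
    rw [hz2, hz3]
    push_cast
    linear_combination z * h

theorem seriesSum_zero (a : ℕ → ℂ) : seriesSum a 0 = a 0 := by
  rw [seriesSum, tsum_eq_single 0]
  · simp
  · intro k hk; simp [hk]

theorem EntireCoeff.continuous_comp_sq {a : ℕ → ℂ} (ha : EntireCoeff a) :
    Continuous fun z : ℂ => seriesSum a (z ^ 2 / 4) :=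
  continuous_iff_continuousAt.2 fun z => (ha.hasDerivAt_comp_sq z).continuousAt

theorem EntireCoeff.shift {a : ℕ → ℂ} (ha : EntireCoeff a) : EntireCoeff fun k => a (k + 1) := by
  intro r hr
  have h := (summable_nat_add_iff 1).2 (ha (r + 1) (by positivity))
  refine Summable.of_nonneg_of_le (fun k => by positivity) (fun k => ?_) h
  have h3 : r ^ k ≤ (r + 1) ^ (k + 1) := by
    calc r ^ k ≤ (r + 1) ^ k := by gcongr; linarith
      _ ≤ (r + 1) ^ (k + 1) := pow_le_pow_right₀ (by linarith) (Nat.le_succ k)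
  gcongr

theorem EntireCoeff.seriesSum_eq {a : ℕ → ℂ} (ha : EntireCoeff a) (y : ℂ) :
    seriesSum a y = a 0 + y * seriesSum (fun k => a (k + 1)) y := by
  rw [seriesSum, (ha.summable y).tsum_eq_zero_add, seriesSum, ← tsum_mul_left, pow_zero, mul_one]
  congr 1
  exact tsum_congr fun k => by ring

theorem tendsto_besselI_zero : Tendsto (fun u : ℝ => besselI u) (𝓝[>] 0) (𝓝 1) := by
  have h : Continuous fun u : ℝ => besselI u :=
    entireCoeff_besselCoeff.continuous_comp_sq.comp continuous_ofReal
  have := (h.tendsto 0).mono_left (nhdsWithin_le_nhds (s := Ioi (0 : ℝ)))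
  simpa [besselI, seriesSum_zero, besselCoeff] using this

theorem log_half_ofReal {u : ℝ} (hu : 0 < u) : log ((u : ℂ) / 2) = (Real.log (u / 2) : ℂ) := by
  rw [show (u : ℂ) / 2 = ((u / 2 : ℝ) : ℂ) by push_cast; ring, ofReal_log (by positivity)]

/-- Reduces to `u log u → 0`: any factor vanishing to first order beats the logarithm. -/
theorem tendsto_log_half_mul_zero {h : ℝ → ℂ} (hh : Continuous h) :
    Tendsto (fun u : ℝ => (log ((u : ℂ) / 2) + Real.eulerMascheroniConstant) * ((u : ℂ) * h u))
      (𝓝[>] 0) (𝓝 0) := by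
  have h1 : Tendsto (fun u : ℝ => Real.log u * u) (𝓝[>] 0) (𝓝 0) := by
    simpa using tendsto_log_mul_rpow_nhdsGT_zero zero_lt_one
  have h2 : Tendsto (fun u : ℝ => ((Real.log u * u : ℝ) : ℂ) * h u
      + ((-Real.log 2 + Real.eulerMascheroniConstant : ℝ) : ℂ) * ((u : ℂ) * h u))
      (𝓝[>] 0) (𝓝 (((0 : ℝ) : ℂ) * h 0
        + ((-Real.log 2 + Real.eulerMascheroniConstant : ℝ) : ℂ) * (((0 : ℝ) : ℂ) * h 0))) := by
    refine (((continuous_ofReal.tendsto _).comp h1).mul ?_).add ?_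
    · exact (hh.tendsto 0).mono_left nhdsWithin_le_nhds
    · have : Continuous fun u : ℝ => ((-Real.log 2 + Real.eulerMascheroniConstant : ℝ) : ℂ) * ((u : ℂ) * h u) := by fun_prop
      exact (this.tendsto 0).mono_left nhdsWithin_le_nhds
  simp only [ofReal_zero, zero_mul, mul_zero, add_zero] at h2
  refine h2.congr' ?_
  filter_upwards [self_mem_nhdsWithin] with u hu
  rw [log_half_ofReal hu, Real.log_div (ne_of_gt hu) two_ne_zero]
  push_cast; ring

theorem tendsto_besselKSeries_zero :
    Tendsto (fun u : ℝ => besselKSeries u + (log ((u : ℂ) / 2) + Real.eulerMascheroniConstant))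
      (𝓝[>] 0) (𝓝 0) := by
  have hs : EntireCoeff fun k => besselCoeff (k + 1) := entireCoeff_besselCoeff.shift
  have h1 := tendsto_log_half_mul_zero (h := fun u : ℝ =>
    -((u : ℂ) * seriesSum (fun k => besselCoeff (k + 1)) ((u : ℂ) ^ 2 / 4) / 4))
    (((continuous_ofReal.mul (hs.continuous_comp_sq.comp continuous_ofReal)).div_const 4).neg)
  have h2 : Tendsto (fun u : ℝ => seriesSum besselHarmonicCoeff ((u : ℂ) ^ 2 / 4)) (𝓝[>] 0)
      (𝓝 0) := by
    have h : Continuous fun u : ℝ => seriesSum besselHarmonicCoeff ((u : ℂ) ^ 2 / 4) :=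
      entireCoeff_besselHarmonicCoeff.continuous_comp_sq.comp continuous_ofReal
    have := (h.tendsto 0).mono_left (nhdsWithin_le_nhds (s := Ioi (0 : ℝ)))
    simpa [seriesSum_zero, besselHarmonicCoeff] using this
  have h3 := h1.add h2
  rw [add_zero] at h3
  refine h3.congr fun u => ?_
  rw [besselKSeries, besselI, entireCoeff_besselCoeff.seriesSum_eq]
  simp only [besselCoeff, Nat.factorial_zero]
  push_cast; ring

/-- The Wronskian is constant, so its value can be read off as `u → 0+`. The logarithms cancel
identically, leaving `-I₀²` plus terms that tend to zero. -/
theorem wronskian_besselI_besselKSeries (z : ℂ) (hz : z ∈ slitPlane) :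
    besselI z * besselKSeriesDeriv z - besselIDeriv z * besselKSeries z = -1 := by
  obtain ⟨c, hc⟩ := isModifiedBesselPair_besselI.wronskian_const isModifiedBesselPair_besselKSeries
  rw [hc z hz]
  have hE' : Continuous fun u : ℝ => seriesSum (derivCoeff besselCoeff) ((u : ℂ) ^ 2 / 4) :=
    entireCoeff_besselCoeff.derivCoeff.continuous_comp_sq.comp continuous_ofReal
  have hN : Continuous fun u : ℝ => seriesSum besselHarmonicCoeff ((u : ℂ) ^ 2 / 4) :=
    entireCoeff_besselHarmonicCoeff.continuous_comp_sq.comp continuous_ofReal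
  have hN' : Continuous fun u : ℝ => seriesSum (derivCoeff besselHarmonicCoeff) ((u : ℂ) ^ 2 / 4) :=
    entireCoeff_besselHarmonicCoeff.derivCoeff.continuous_comp_sq.comp continuous_ofReal
  have hI := tendsto_besselI_zero
  have h1 : Tendsto (fun u : ℝ => besselI u * (-besselI u + (u : ℂ) ^ 2 / 2 *
      seriesSum (derivCoeff besselHarmonicCoeff) ((u : ℂ) ^ 2 / 4))
      - (u : ℂ) ^ 2 / 2 * seriesSum (derivCoeff besselCoeff) ((u : ℂ) ^ 2 / 4) *
        seriesSum besselHarmonicCoeff ((u : ℂ) ^ 2 / 4)) (𝓝[>] 0) (𝓝 (1 * (-1 + 0) - 0)) := by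
    refine (hI.mul (hI.neg.add ?_)).sub ?_
    · have : Continuous fun u : ℝ => (u : ℂ) ^ 2 / 2 *
        seriesSum (derivCoeff besselHarmonicCoeff) ((u : ℂ) ^ 2 / 4) := by fun_prop
      have := (this.tendsto 0).mono_left (nhdsWithin_le_nhds (s := Ioi (0 : ℝ)))
      simpa using this
    · have : Continuous fun u : ℝ => (u : ℂ) ^ 2 / 2 *
        seriesSum (derivCoeff besselCoeff) ((u : ℂ) ^ 2 / 4) *
        seriesSum besselHarmonicCoeff ((u : ℂ) ^ 2 / 4) := by fun_prop
      have := (this.tendsto 0).mono_left (nhdsWithin_le_nhds (s := Ioi (0 : ℝ)))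
      simpa using this
  refine tendsto_nhds_unique (tendsto_const_nhds.congr' ?_) (by simpa using h1)
  filter_upwards [self_mem_nhdsWithin] with u hu
  rw [← hc (u : ℂ) (ofReal_mem_slitPlane.2 hu), besselKSeries, besselKSeriesDeriv, besselIDeriv]
  ring

/-- A solution with the logarithmic behaviour of `besselKSeries` at `0` equals it. -/
theorem IsModifiedBesselPair.eq_besselKSeries {f g : ℂ → ℂ} (h : IsModifiedBesselPair f g)
    (h0 : Tendsto (fun u : ℝ => f u + (log ((u : ℂ) / 2) + Real.eulerMascheroniConstant))
      (𝓝[>] 0) (𝓝 0)) {z : ℂ} (hz : z ∈ slitPlane) : f z = besselKSeries z := by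
  obtain ⟨b, hb⟩ := isModifiedBesselPair_besselI.wronskian_const h
  obtain ⟨a, ha⟩ := isModifiedBesselPair_besselKSeries.wronskian_const h
  -- Cramer's rule: the coefficients of `f` in the basis `I₀`, `K₀` are its Wronskians with the
  -- basis.
  have key : ∀ z ∈ slitPlane, f z = a * besselI z - b * besselKSeries z := by
    intro z hz
    have hw := wronskian_besselI_besselKSeries z hz
    rw [← ha z hz, ← hb z hz]
    linear_combination f z * hw
  have hI := tendsto_besselI_zero
  have hL : Tendsto (fun u : ℝ => (log ((u : ℂ) / 2) + Real.eulerMascheroniConstant)⁻¹)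
      (𝓝[>] 0) (𝓝 0) := by
    have h1 : Tendsto (fun u : ℝ => Real.log u + (-Real.log 2 + Real.eulerMascheroniConstant))
        (𝓝[>] 0) atBot := tendsto_atBot_add_const_right _ _ Real.tendsto_log_nhdsGT_zero
    have h2 := (continuous_ofReal.tendsto 0).comp (tendsto_inv_atBot_zero.comp h1)
    rw [ofReal_zero] at h2
    refine h2.congr' ?_
    filter_upwards [self_mem_nhdsWithin] with u hu
    rw [log_half_ofReal hu, Real.log_div (ne_of_gt hu) two_ne_zero]
    simp; ring
  have hdiff : Tendsto (fun u : ℝ => a * besselI u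
      - (b + 1) * besselKSeries u) (𝓝[>] 0) (𝓝 0) := by
    have := h0.sub tendsto_besselKSeries_zero
    rw [sub_zero] at this
    refine this.congr' ?_
    filter_upwards [self_mem_nhdsWithin] with u hu
    rw [key u (ofReal_mem_slitPlane.2 hu)]; ring
  -- Dividing by the logarithm, which blows up, isolates the coefficient of `K₀`; what remains is
  -- then the constant `a`.
  have hb1 : b + 1 = 0 := by
    have h1 : Tendsto (fun u : ℝ => (a * besselI u - (b + 1) * besselKSeries u
        - a * besselI u + (b + 1) * (besselKSeries u
          + (log ((u : ℂ) / 2) + Real.eulerMascheroniConstant)))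
        * (log ((u : ℂ) / 2) + Real.eulerMascheroniConstant)⁻¹) (𝓝[>] 0)
        (𝓝 ((0 - a * 1 + (b + 1) * 0) * 0)) :=
      ((hdiff.sub (hI.const_mul a)).add (tendsto_besselKSeries_zero.const_mul _)).mul hL
    rw [mul_zero] at h1
    refine tendsto_nhds_unique (tendsto_const_nhds.congr' ?_) h1
    have hne : ∀ᶠ u : ℝ in 𝓝[>] 0, (log ((u : ℂ) / 2) + (Real.eulerMascheroniConstant : ℂ)) ≠ 0 := by
      have h1 : Tendsto (fun u : ℝ => Real.log u + (-Real.log 2 + Real.eulerMascheroniConstant))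
        (𝓝[>] 0) atBot := tendsto_atBot_add_const_right _ _ Real.tendsto_log_nhdsGT_zero
      filter_upwards [self_mem_nhdsWithin, h1.eventually (eventually_lt_atBot 0)] with u hu h3
      rw [log_half_ofReal hu, Real.log_div (ne_of_gt hu) two_ne_zero, ← ofReal_add]
      refine ofReal_ne_zero.2 (ne_of_lt ?_)
      linarith
    filter_upwards [hne] with u hu
    field_simp; ring
  rw [hb1] at hdiff
  have ha0 : a = 0 := by
    refine tendsto_nhds_unique ?_ hdiff
    simpa using hI.const_mul a
  rw [key z hz, ha0, show b = -1 by linear_combination hb1]; ring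

/-! ### The Laplace integral and its differential equation -/

theorem add_sq_mem_slitPlane {z : ℂ} (hz : z ∈ slitPlane) (r : ℝ) :
    ((r ^ 2 : ℝ) : ℂ) + 2 * z ∈ slitPlane := by
  rw [mem_slitPlane_iff] at hz ⊢
  simp only [add_re, add_im, ofReal_re, ofReal_im, mul_re, mul_im, re_ofNat, im_ofNat, zero_mul,
    sub_zero, add_zero, zero_add]
  rcases hz with h | h
  · left; nlinarith [sq_nonneg r]
  · right; intro h'; apply h; linarith

/-- The points `-r²/2` lie on the removed half-line, so they keep a distance from `z`. The bound is
uniform in `r` and provides every domination needed below. -/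
theorem exists_ball_le_norm_add_sq {z : ℂ} (hz : z ∈ slitPlane) :
    ∃ ε > 0, ∀ w ∈ Metric.ball z ε, w ∈ slitPlane ∧
      ∀ r : ℝ, ε ≤ ‖((r ^ 2 : ℝ) : ℂ) + 2 * w‖ := by
  obtain ⟨δ, hδ, hb⟩ := Metric.isOpen_iff.1 isOpen_slitPlane z hz
  refine ⟨δ / 2, by positivity, fun w hw => ⟨hb (Metric.ball_subset_ball (by linarith) hw),
    fun r => ?_⟩⟩
  have h1 : ((-(r ^ 2 / 2) : ℝ) : ℂ) ∉ Metric.ball z δ := fun h => by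
    have := hb h
    rw [ofReal_mem_slitPlane] at this
    nlinarith [sq_nonneg r]
  rw [Metric.mem_ball, not_lt, dist_eq_norm] at h1
  rw [Metric.mem_ball, dist_eq_norm] at hw
  have h2 : ‖w - ((-(r ^ 2 / 2) : ℝ) : ℂ)‖ * 2 = ‖((r ^ 2 : ℝ) : ℂ) + 2 * w‖ := by
    rw [show ((r ^ 2 : ℝ) : ℂ) + 2 * w = (w - ((-(r ^ 2 / 2) : ℝ) : ℂ)) * 2 by push_cast; ring,
      norm_mul]
    norm_num
  have h3 : ‖((-(r ^ 2 / 2) : ℝ) : ℂ) - z‖ ≤ ‖w - ((-(r ^ 2 / 2) : ℝ) : ℂ)‖ + ‖w - z‖ := by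
    rw [← norm_neg (w - ((-(r ^ 2 / 2) : ℝ) : ℂ))]
    refine le_trans (le_of_eq ?_) (norm_add_le _ _)
    congr 1; ring
  linarith

/-- The integrand of `gaussPow`. -/
noncomputable def gaussPowKernel (a : ℝ) (z : ℂ) (r : ℝ) : ℂ :=
  (Real.exp (-r ^ 2) : ℂ) * (((r ^ 2 : ℝ) : ℂ) + 2 * z) ^ ((-a : ℝ) : ℂ)

/-- `∫ exp(-r²) (r² + 2z)^(-a) dr`. -/
noncomputable def gaussPow (a : ℝ) (z : ℂ) : ℂ := ∫ r : ℝ, gaussPowKernel a z r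

theorem continuous_gaussPowKernel (a : ℝ) {z : ℂ} (hz : z ∈ slitPlane) :
    Continuous (gaussPowKernel a z) := by
  unfold gaussPowKernel
  refine Continuous.mul (by fun_prop) ?_
  refine continuous_iff_continuousAt.2 fun r => ContinuousAt.cpow (by fun_prop) (by fun_prop) ?_
  exact add_sq_mem_slitPlane hz r

theorem norm_gaussPowKernel (a : ℝ) (z : ℂ) (r : ℝ) :
    ‖gaussPowKernel a z r‖ = Real.exp (-r ^ 2) * ‖((r ^ 2 : ℝ) : ℂ) + 2 * z‖ ^ (-a) := by
  rw [gaussPowKernel, norm_mul, norm_real, Real.norm_of_nonneg (Real.exp_pos _).le, norm_cpow_real]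

theorem norm_gaussPowKernel_le {a ε : ℝ} (ha : 0 ≤ a) (hε : 0 < ε) {z : ℂ} {r : ℝ}
    (h : ε ≤ ‖((r ^ 2 : ℝ) : ℂ) + 2 * z‖) :
    ‖gaussPowKernel a z r‖ ≤ Real.exp (-r ^ 2) * ε ^ (-a) := by
  rw [norm_gaussPowKernel]
  exact mul_le_mul_of_nonneg_left (Real.rpow_le_rpow_of_nonpos hε h (by linarith))
    (Real.exp_pos _).le

theorem integrable_exp_neg_sq : Integrable fun r : ℝ => Real.exp (-r ^ 2) := by
  simpa using integrable_exp_neg_mul_sq one_pos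

theorem integrable_gaussPowKernel {a : ℝ} (ha : 0 ≤ a) {z : ℂ} (hz : z ∈ slitPlane) :
    Integrable (gaussPowKernel a z) := by
  obtain ⟨ε, hε, h⟩ := exists_ball_le_norm_add_sq hz
  refine (integrable_exp_neg_sq.mul_const (ε ^ (-a))).mono'
    (continuous_gaussPowKernel a hz).aestronglyMeasurable (Eventually.of_forall fun r => ?_)
  exact norm_gaussPowKernel_le ha hε ((h z (Metric.mem_ball_self hε)).2 r)

theorem hasDerivAt_gaussPow {a : ℝ} (ha : 0 ≤ a) {z : ℂ} (hz : z ∈ slitPlane) :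
    HasDerivAt (gaussPow a) (-2 * a * gaussPow (a + 1) z) z := by
  obtain ⟨ε, hε, h⟩ := exists_ball_le_norm_add_sq hz
  have key := hasDerivAt_integral_of_dominated_loc_of_deriv_le (μ := volume)
    (F := fun w r => gaussPowKernel a w r)
    (F' := fun w r => -2 * a * gaussPowKernel (a + 1) w r) (x₀ := z)
    (bound := fun r => ‖(-2 * a : ℂ)‖ * (Real.exp (-r ^ 2) * ε ^ (-(a + 1))))
    (Metric.ball_mem_nhds z hε)
    (by
      filter_upwards [Metric.ball_mem_nhds z hε] with w hw
      exact (continuous_gaussPowKernel a (h w hw).1).aestronglyMeasurable)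
    (integrable_gaussPowKernel ha hz)
    ((continuous_gaussPowKernel (a + 1) hz).const_mul _).aestronglyMeasurable
    (Eventually.of_forall fun r w hw => by
      rw [norm_mul]
      gcongr
      exact norm_gaussPowKernel_le (by linarith) hε ((h w hw).2 r))
    ((integrable_exp_neg_sq.mul_const _).const_mul _)
    (Eventually.of_forall fun r w hw => by
      have h1 : HasDerivAt (fun w : ℂ => ((r ^ 2 : ℝ) : ℂ) + 2 * w) 2 w := by
        simpa using ((hasDerivAt_id w).const_mul (2 : ℂ)).const_add ((r ^ 2 : ℝ) : ℂ)
      have h2 := (h1.cpow_const (c := ((-a : ℝ) : ℂ)) (add_sq_mem_slitPlane (h w hw).1 r)).const_mul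
        (Real.exp (-r ^ 2) : ℂ)
      refine h2.congr_deriv ?_
      rw [gaussPowKernel, show ((-(a + 1) : ℝ) : ℂ) = ((-a : ℝ) : ℂ) - 1 by push_cast; ring]
      push_cast; ring)
  refine key.2.congr_deriv ?_
  rw [gaussPow, ← integral_const_mul]

/-- The equation `z G'' + (1 - 2z) G' - G = 0` for `G = gaussPow (1/2)`. -/
theorem gaussPow_ode {z : ℂ} (hz : z ∈ slitPlane) :
    3 * z * gaussPow (5 / 2) z - (1 - 2 * z) * gaussPow (3 / 2) z - gaussPow (1 / 2) z = 0 := by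
  have i1 := integrable_gaussPowKernel (a := 1 / 2) (by norm_num) hz
  have i3 := integrable_gaussPowKernel (a := 3 / 2) (by norm_num) hz
  have i5 := integrable_gaussPowKernel (a := 5 / 2) (by norm_num) hz
  have hP : ∀ r : ℝ, ((r ^ 2 : ℝ) : ℂ) + 2 * z ≠ 0 := fun r =>
    slitPlane_ne_zero (add_sq_mem_slitPlane hz r)
  have s3 : ∀ r : ℝ, gaussPowKernel (3 / 2) z r
      = (((r ^ 2 : ℝ) : ℂ) + 2 * z) * gaussPowKernel (5 / 2) z r := by
    intro r
    rw [gaussPowKernel, gaussPowKernel,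
      show ((-(3 / 2) : ℝ) : ℂ) = ((-(5 / 2) : ℝ) : ℂ) + 1 by push_cast; ring,
      cpow_add _ _ (hP r), cpow_one]
    ring
  have s1 : ∀ r : ℝ, gaussPowKernel (1 / 2) z r
      = (((r ^ 2 : ℝ) : ℂ) + 2 * z) * gaussPowKernel (3 / 2) z r := by
    intro r
    rw [gaussPowKernel, gaussPowKernel,
      show ((-(1 / 2) : ℝ) : ℂ) = ((-(3 / 2) : ℝ) : ℂ) + 1 by push_cast; ring,
      cpow_add _ _ (hP r), cpow_one]
    ring
  have ii : Integrable fun r : ℝ => 2 * (3 * z * gaussPowKernel (5 / 2) z r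
      - (1 - 2 * z) * gaussPowKernel (3 / 2) z r - gaussPowKernel (1 / 2) z r) :=
    (((i5.const_mul _).sub (i3.const_mul _)).sub i1).const_mul 2
  -- The equation holds under the integral up to a total derivative: twice the integrand is the
  -- derivative of `r · gaussPowKernel (3/2) z r`, which integrates to zero.
  have hd : ∀ r : ℝ, HasDerivAt (fun r : ℝ => (r : ℂ) * gaussPowKernel (3 / 2) z r)
      (2 * (3 * z * gaussPowKernel (5 / 2) z r - (1 - 2 * z) * gaussPowKernel (3 / 2) z r
        - gaussPowKernel (1 / 2) z r)) r := by
    intro r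
    have hr : (r : ℂ) ^ 2 + 2 * z ∈ slitPlane := by
      have := add_sq_mem_slitPlane hz r
      rwa [ofReal_pow] at this
    have d3 : HasDerivAt (fun w : ℂ => w ^ 2 + 2 * z) (2 * (r : ℂ)) (r : ℂ) := by
      simpa using (hasDerivAt_pow 2 (r : ℂ)).add_const (2 * z)
    have d4 := ((hasDerivAt_id (r : ℂ)).mul ((hasDerivAt_pow 2 (r : ℂ)).neg.cexp.mul
      (d3.cpow_const (c := ((-(3 / 2) : ℝ) : ℂ)) hr))).comp_ofReal
    have d5 := d4.congr_of_eventuallyEq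
      (f₁ := fun r : ℝ => (r : ℂ) * gaussPowKernel (3 / 2) z r)
      (Eventually.of_forall fun t => by simp [gaussPowKernel])
    refine d5.congr_deriv ?_
    have e5 : cexp (-(r : ℂ) ^ 2) * ((r : ℂ) ^ 2 + 2 * z) ^ (((-(3 / 2) : ℝ) : ℂ) - 1)
        = gaussPowKernel (5 / 2) z r := by
      rw [gaussPowKernel, show ((-(5 / 2) : ℝ) : ℂ) = ((-(3 / 2) : ℝ) : ℂ) - 1 by push_cast; ring]
      push_cast; rfl
    have e3 : cexp (-(r : ℂ) ^ 2) * ((r : ℂ) ^ 2 + 2 * z) ^ (((-(3 / 2) : ℝ) : ℂ))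
        = gaussPowKernel (3 / 2) z r := by
      rw [gaussPowKernel]; push_cast; rfl
    have s3 := s3 r
    have s1 := s1 r
    rw [s1]
    simp only [id, Pi.neg_apply, Pi.mul_apply]
    simp only [ofReal_pow] at s3 ⊢
    generalize gaussPowKernel (5 / 2) z r = k5 at *
    generalize gaussPowKernel (3 / 2) z r = k3 at *
    generalize ((r : ℂ) ^ 2 + 2 * z) ^ (((-(3 / 2) : ℝ) : ℂ) - 1) = p5 at *
    generalize ((r : ℂ) ^ 2 + 2 * z) ^ (((-(3 / 2) : ℝ) : ℂ)) = p3 at *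
    push_cast
    linear_combination 3 * s3 + (1 - 2 * (r : ℂ) ^ 2) * e3 - 3 * (r : ℂ) ^ 2 * e5
  have hint : Integrable fun r : ℝ => (r : ℂ) * gaussPowKernel (3 / 2) z r := by
    obtain ⟨ε, hε, h⟩ := exists_ball_le_norm_add_sq hz
    have hb : Integrable fun r : ℝ => r * Real.exp (-r ^ 2) := by
      simpa using integrable_mul_exp_neg_mul_sq one_pos
    refine (hb.norm.mul_const (ε ^ (-(3 / 2) : ℝ))).mono'
      (continuous_ofReal.mul (continuous_gaussPowKernel _ hz)).aestronglyMeasurable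
      (Eventually.of_forall fun r => ?_)
    rw [norm_mul, norm_mul, norm_real, mul_assoc, Real.norm_of_nonneg (Real.exp_pos _).le]
    gcongr
    exact norm_gaussPowKernel_le (by norm_num) hε ((h z (Metric.mem_ball_self hε)).2 r)
  have i53 : Integrable fun r : ℝ => 3 * z * gaussPowKernel (5 / 2) z r
      - (1 - 2 * z) * gaussPowKernel (3 / 2) z r := (i5.const_mul _).sub (i3.const_mul _)
  have h0 := integral_eq_zero_of_hasDerivAt_of_integrable hd ii hint
  rw [integral_const_mul, integral_sub i53 i1,
    integral_sub (i5.const_mul _) (i3.const_mul _), integral_const_mul, integral_const_mul] at h0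
  exact (mul_eq_zero.1 h0).resolve_left two_ne_zero

/-- The modified Bessel function `K₀`, by its Laplace integral. -/
noncomputable def besselK (z : ℂ) : ℂ := exp (-z) * gaussPow (1 / 2) z

/-- `z K₀'(z)`. -/
noncomputable def besselKDeriv (z : ℂ) : ℂ :=
  z * (exp (-z) * (-gaussPow (3 / 2) z - gaussPow (1 / 2) z))

theorem isModifiedBesselPair_besselK : IsModifiedBesselPair besselK besselKDeriv := by
  intro z hz
  have hz0 := slitPlane_ne_zero hz
  have d1 := hasDerivAt_gaussPow (a := 1 / 2) (by norm_num) hz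
  have d3 := hasDerivAt_gaussPow (a := 3 / 2) (by norm_num) hz
  norm_num at d1 d3
  have de : HasDerivAt (fun z : ℂ => exp (-z)) (-exp (-z)) z := by
    simpa using (hasDerivAt_neg z).cexp
  have ho := gaussPow_ode hz
  constructor
  · refine (de.mul d1).congr_deriv ?_
    rw [besselKDeriv]; field_simp; ring
  · refine ((hasDerivAt_id z).mul (de.mul (d3.neg.sub d1))).congr_deriv ?_
    simp only [besselK, id, Pi.neg_apply, Pi.mul_apply, Pi.sub_apply]
    linear_combination cexp (-z) * ho

/-! ### Logarithmic behaviour of the Laplace integral at zero -/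

/-- Replaces `|log t|` by a majorant whose Gamma moments are known in closed form. -/
theorem abs_log_le (t : ℝ) (ht : 0 < t) : |Real.log t| ≤ 2 * t - Real.log t := by
  rcases abs_cases (Real.log t) with ⟨h, _⟩ | ⟨h, _⟩ <;> rw [h] <;>
    linarith [Real.log_le_sub_one_of_pos ht]

/-- `∫₀^∞ 2 r e^{-r²} log r dr = -γ/2`. -/
theorem integral_mul_exp_neg_sq_mul_log :
    IntegrableOn (fun r : ℝ => 2 * r * Real.exp (-r ^ 2) * Real.log r) (Ioi 0) ∧
    ∫ r in Ioi (0 : ℝ), 2 * r * Real.exp (-r ^ 2) * Real.log r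
      = -Real.eulerMascheroniConstant / 2 := by
  obtain ⟨h1, h2⟩ := integral_exp_neg_mul_pow_mul_log 0
  simp only [pow_zero, mul_one, Nat.factorial_zero, Nat.cast_one, harmonic_zero, Rat.cast_zero,
    zero_sub, one_mul] at h1 h2
  have e : ∀ r ∈ Ioi (0 : ℝ), (2 * r ^ ((2 : ℝ) - 1)) • (Real.exp (-(r ^ (2 : ℝ))) * Real.log (r ^ (2 : ℝ)))
      = 2 * (2 * r * Real.exp (-r ^ 2) * Real.log r) := by
    intro r hr
    rw [show (2 : ℝ) - 1 = 1 by norm_num, Real.rpow_one, Real.rpow_two, Real.log_pow, smul_eq_mul]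
    push_cast; ring
  have h3 := integral_comp_rpow_Ioi_of_pos (g := fun t => Real.exp (-t) * Real.log t) two_pos
  have h4 := (integrableOn_Ioi_comp_rpow_iff (fun t => Real.exp (-t) * Real.log t)
    (two_ne_zero (α := ℝ))).2 h1
  rw [setIntegral_congr_fun measurableSet_Ioi e, h2, integral_const_mul] at h3
  refine ⟨?_, by linarith⟩
  have h5 : IntegrableOn (fun r : ℝ => 2 * (2 * r * Real.exp (-r ^ 2) * Real.log r)) (Ioi 0) := by
    refine h4.congr_fun (fun r hr => ?_) measurableSet_Ioi
    rw [← e r hr, abs_two]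
  have h6 : IntegrableOn (fun r : ℝ => 1 / 2 * (2 * (2 * r * Real.exp (-r ^ 2) * Real.log r)))
      (Ioi 0) := h5.const_mul _
  exact h6.congr_fun (fun r _ => by dsimp only; ring) measurableSet_Ioi

theorem integral_two_mul_mul_exp_neg_sq :
    IntegrableOn (fun r : ℝ => 2 * r * Real.exp (-r ^ 2)) (Ioi 0) ∧
    ∫ r in Ioi (0 : ℝ), 2 * r * Real.exp (-r ^ 2) = 1 := by
  have hd : ∀ x ∈ Ici (0 : ℝ), HasDerivAt (fun r : ℝ => -Real.exp (-r ^ 2))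
      (2 * x * Real.exp (-x ^ 2)) x := by
    intro x _
    have := ((hasDerivAt_pow 2 x).neg.exp).neg
    refine this.congr_deriv ?_
    simp; ring
  have hb : IntegrableOn (fun r : ℝ => 2 * r * Real.exp (-r ^ 2)) (Ioi 0) := by
    have : Integrable fun r : ℝ => r * Real.exp (-r ^ 2) := by
      simpa using integrable_mul_exp_neg_mul_sq one_pos
    simpa [mul_assoc] using (this.const_mul 2).integrableOn
  have ht : Tendsto (fun r : ℝ => -Real.exp (-r ^ 2)) atTop (𝓝 (-0)) :=
    (Real.tendsto_exp_atBot.comp (tendsto_neg_atTop_atBot.comp (tendsto_pow_atTop two_ne_zero))).neg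
  refine ⟨hb, ?_⟩
  rw [integral_Ioi_of_hasDerivAt_of_tendsto' hd hb ht]
  simp

/-- `log (r + √(r² + a))`, an antiderivative of `1 / √(r² + a)`. -/
noncomputable def logAddSqrt (a r : ℝ) : ℝ := Real.log (r + √(r ^ 2 + a))

theorem hasDerivAt_logAddSqrt {a r : ℝ} (ha : 0 < a) (hr : 0 ≤ r) :
    HasDerivAt (logAddSqrt a) (1 / √(r ^ 2 + a)) r := by
  have hp : 0 < r ^ 2 + a := by positivity
  have hs : 0 < √(r ^ 2 + a) := Real.sqrt_pos.2 hp
  have h1 : HasDerivAt (fun r : ℝ => r ^ 2 + a) (2 * r) r := by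
    simpa using (hasDerivAt_pow 2 r).add_const a
  have h := ((hasDerivAt_id r).add (h1.sqrt hp.ne')).log
    (by simp only [id, Pi.add_apply]; positivity)
  refine h.congr_deriv ?_
  simp only [id, Pi.add_apply]
  have : r + √(r ^ 2 + a) ≠ 0 := by positivity
  field_simp
  ring

theorem log_two_mul_le_logAddSqrt {a r : ℝ} (ha : 0 < a) (hr : 0 < r) :
    Real.log (2 * r) ≤ logAddSqrt a r := by
  refine Real.log_le_log (by positivity) ?_
  have : r ≤ √(r ^ 2 + a) := Real.le_sqrt_of_sq_le (by linarith)
  linarith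

/-- From `√(r² + a) ≤ r + √a` and `log (1 + x) ≤ x`. The singularity `1/r` of the error is harmless
against the weight `2 r e^{-r²}`. -/
theorem logAddSqrt_le {a r : ℝ} (ha : 0 < a) (hr : 0 < r) :
    logAddSqrt a r ≤ Real.log (2 * r) + √a / (2 * r) := by
  have h1 : √(r ^ 2 + a) ≤ r + √a := by
    rw [Real.sqrt_le_left (by positivity)]
    nlinarith [Real.sq_sqrt ha.le, Real.sqrt_nonneg a]
  have h2 : logAddSqrt a r ≤ Real.log (2 * r * (1 + √a / (2 * r))) := by
    refine Real.log_le_log (by positivity) ?_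
    rw [show 2 * r * (1 + √a / (2 * r)) = 2 * r + √a by field_simp]
    linarith
  rw [Real.log_mul (by positivity) (by positivity)] at h2
  have h3 := Real.log_le_sub_one_of_pos (show 0 < 1 + √a / (2 * r) by positivity)
  linarith

theorem integral_mul_log_two_mul :
    IntegrableOn (fun r : ℝ => 2 * r * Real.exp (-r ^ 2) * Real.log (2 * r)) (Ioi 0) ∧
    ∫ r in Ioi (0 : ℝ), 2 * r * Real.exp (-r ^ 2) * Real.log (2 * r)
      = Real.log 2 - Real.eulerMascheroniConstant / 2 := by
  obtain ⟨h1, h2⟩ := integral_mul_exp_neg_sq_mul_log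
  obtain ⟨h3, h4⟩ := integral_two_mul_mul_exp_neg_sq
  have e : ∀ r ∈ Ioi (0 : ℝ), 2 * r * Real.exp (-r ^ 2) * Real.log r
      + Real.log 2 * (2 * r * Real.exp (-r ^ 2)) = 2 * r * Real.exp (-r ^ 2) * Real.log (2 * r) := by
    intro r hr
    rw [Real.log_mul two_ne_zero (ne_of_gt hr)]; ring
  refine ⟨(h1.add (h3.const_mul (Real.log 2))).congr_fun e measurableSet_Ioi, ?_⟩
  rw [← setIntegral_congr_fun measurableSet_Ioi e, integral_add h1 (h3.const_mul _),
    integral_const_mul, h2, h4]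
  ring

/-- `∫₀^∞ 2 r e^{-r²} log (r + √(r² + a)) dr` is squeezed to its value at `a = 0`. -/
theorem integral_logAddSqrt_bounds {a : ℝ} (ha : 0 < a) :
    IntegrableOn (fun r : ℝ => 2 * r * Real.exp (-r ^ 2) * logAddSqrt a r) (Ioi 0) ∧
    Real.log 2 - Real.eulerMascheroniConstant / 2
      ≤ ∫ r in Ioi (0 : ℝ), 2 * r * Real.exp (-r ^ 2) * logAddSqrt a r ∧
    ∫ r in Ioi (0 : ℝ), 2 * r * Real.exp (-r ^ 2) * logAddSqrt a r
      ≤ Real.log 2 - Real.eulerMascheroniConstant / 2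
        + √a * ∫ r in Ioi (0 : ℝ), Real.exp (-r ^ 2) := by
  obtain ⟨h1, h2⟩ := integral_mul_log_two_mul
  have h3 : IntegrableOn (fun r : ℝ => √a * Real.exp (-r ^ 2)) (Ioi 0) :=
    (integrable_exp_neg_sq.const_mul _).integrableOn
  have lo : ∀ r ∈ Ioi (0 : ℝ), 2 * r * Real.exp (-r ^ 2) * Real.log (2 * r)
      ≤ 2 * r * Real.exp (-r ^ 2) * logAddSqrt a r := by
    intro r hr
    have hr' : 0 < r := hr
    exact mul_le_mul_of_nonneg_left (log_two_mul_le_logAddSqrt ha hr) (by positivity)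
  have hi : ∀ r ∈ Ioi (0 : ℝ), 2 * r * Real.exp (-r ^ 2) * logAddSqrt a r
      ≤ 2 * r * Real.exp (-r ^ 2) * Real.log (2 * r) + √a * Real.exp (-r ^ 2) := by
    intro r hr
    have hr' : 0 < r := hr
    refine (mul_le_mul_of_nonneg_left (logAddSqrt_le ha hr) (by positivity)).trans (le_of_eq ?_)
    field_simp
  have hm : IntegrableOn (fun r : ℝ => 2 * r * Real.exp (-r ^ 2) * logAddSqrt a r) (Ioi 0) := by
    refine integrable_of_le_of_le (g₁ := fun r : ℝ => 2 * r * Real.exp (-r ^ 2) * Real.log (2 * r))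
      (g₂ := fun r : ℝ => 2 * r * Real.exp (-r ^ 2) * Real.log (2 * r) + √a * Real.exp (-r ^ 2))
      ?_ ?_ ?_ h1 (h1.add h3)
    · have : ContinuousOn (fun r : ℝ => 2 * r * Real.exp (-r ^ 2) * logAddSqrt a r) (Ioi 0) :=
        ContinuousOn.mul (by fun_prop) fun r hr =>
          (hasDerivAt_logAddSqrt ha (le_of_lt hr)).continuousAt.continuousWithinAt
      exact this.aestronglyMeasurable measurableSet_Ioi
    · exact (ae_restrict_iff' measurableSet_Ioi).2 (Eventually.of_forall lo)
    · exact (ae_restrict_iff' measurableSet_Ioi).2 (Eventually.of_forall hi)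
  refine ⟨hm, ?_, ?_⟩
  · rw [← h2]; exact setIntegral_mono_on h1 hm measurableSet_Ioi lo
  · rw [← h2, ← integral_const_mul, ← integral_add h1 h3]
    exact setIntegral_mono_on hm (h1.add h3) measurableSet_Ioi hi

/-- Integration by parts against `logAddSqrt`; the boundary term at zero is `log √a` and carries the
whole singularity as `a → 0`. -/
theorem integral_exp_neg_sq_div_sqrt {a : ℝ} (ha : 0 < a) :
    ∫ r in Ioi (0 : ℝ), Real.exp (-r ^ 2) / √(r ^ 2 + a)
      = (∫ r in Ioi (0 : ℝ), 2 * r * Real.exp (-r ^ 2) * logAddSqrt a r) - Real.log a / 2 := by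
  obtain ⟨hm, -, -⟩ := integral_logAddSqrt_bounds ha
  have hi : IntegrableOn (fun r : ℝ => Real.exp (-r ^ 2) / √(r ^ 2 + a)) (Ioi 0) := by
    refine ((integrable_exp_neg_sq.div_const (√a)).mono' ?_ (Eventually.of_forall fun r => ?_)).integrableOn
    · refine Continuous.aestronglyMeasurable (Continuous.div (by fun_prop) (by fun_prop) fun r => ?_)
      have : 0 < r ^ 2 + a := by positivity
      positivity
    · rw [Real.norm_of_nonneg (by positivity)]
      gcongr
      nlinarith [sq_nonneg r]
  have hd : ∀ x ∈ Ici (0 : ℝ), HasDerivAt (fun r : ℝ => Real.exp (-r ^ 2) * logAddSqrt a r)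
      (Real.exp (-x ^ 2) / √(x ^ 2 + a) - 2 * x * Real.exp (-x ^ 2) * logAddSqrt a x) x := by
    intro x hx
    have := ((hasDerivAt_pow 2 x).neg.exp).mul (hasDerivAt_logAddSqrt ha hx)
    refine this.congr_deriv ?_
    simp; ring
  have ht : Tendsto (fun r : ℝ => Real.exp (-r ^ 2) * logAddSqrt a r) atTop (𝓝 0) := by
    have h1 : Tendsto (fun r : ℝ => 2 * (r ^ 1 * Real.exp (-r)) + √a * (r ^ 0 * Real.exp (-r))) atTop
        (𝓝 (2 * 0 + √a * 0)) :=
      ((Real.tendsto_pow_mul_exp_neg_atTop_nhds_zero 1).const_mul 2).add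
        ((Real.tendsto_pow_mul_exp_neg_atTop_nhds_zero 0).const_mul _)
    rw [mul_zero, mul_zero, add_zero] at h1
    refine squeeze_zero' ?_ ?_ h1
    · filter_upwards [eventually_ge_atTop 1] with r hr
      have := (Real.log_nonneg (show 1 ≤ 2 * r by linarith)).trans
        (log_two_mul_le_logAddSqrt ha (by linarith))
      positivity
    · filter_upwards [eventually_ge_atTop 1] with r hr
      have h2 := logAddSqrt_le ha (show 0 < r by linarith)
      have h3 := Real.log_le_sub_one_of_pos (show 0 < 2 * r by linarith)
      have h4 : √a / (2 * r) ≤ √a := div_le_self (Real.sqrt_nonneg a) (by linarith)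
      have h5 : Real.exp (-r ^ 2) ≤ Real.exp (-r) := Real.exp_le_exp.2 (by nlinarith)
      calc Real.exp (-r ^ 2) * logAddSqrt a r ≤ Real.exp (-r ^ 2) * (2 * r + √a) := by
            gcongr; linarith
        _ ≤ Real.exp (-r) * (2 * r + √a) := by gcongr
        _ = _ := by ring
  have := integral_Ioi_of_hasDerivAt_of_tendsto' hd (hi.sub hm) ht
  rw [integral_sub hi hm] at this
  have h0 : logAddSqrt a 0 = Real.log a / 2 := by
    rw [logAddSqrt, zero_add, zero_pow two_ne_zero, zero_add, Real.log_sqrt ha.le]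
  simp only [ne_eq, OfNat.ofNat_ne_zero, not_false_eq_true, zero_pow, neg_zero, Real.exp_zero,
    one_mul, h0] at this
  linarith

theorem gaussPow_half_ofReal {u : ℝ} (hu : 0 < u) :
    gaussPow (1 / 2) u
      = ((2 * ∫ r in Ioi (0 : ℝ), Real.exp (-r ^ 2) / √(r ^ 2 + 2 * u) : ℝ) : ℂ) := by
  have e : ∀ r : ℝ, gaussPowKernel (1 / 2) u r
      = ((fun r : ℝ => Real.exp (-r ^ 2) / √(r ^ 2 + 2 * u)) |r| : ℝ) := by
    intro r
    have hp : 0 ≤ r ^ 2 + 2 * u := by positivity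
    simp only [sq_abs]
    rw [gaussPowKernel, show ((r ^ 2 : ℝ) : ℂ) + 2 * u = ((r ^ 2 + 2 * u : ℝ) : ℂ) by push_cast; ring,
      ← ofReal_cpow hp, Real.rpow_neg hp, ← Real.sqrt_eq_rpow]
    push_cast; rw [div_eq_mul_inv]
  rw [gaussPow, integral_congr_ae (Eventually.of_forall e), integral_complex_ofReal,
    integral_comp_abs (f := fun r : ℝ => Real.exp (-r ^ 2) / √(r ^ 2 + 2 * u))]

/-- With `a = 2u`, the singular part is `2 (log 2 - γ/2) - log (2u) = -(log (u/2) + γ)`, and the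
error is of order `√u`. -/
theorem tendsto_gaussPow_zero :
    Tendsto (fun u : ℝ => gaussPow (1 / 2) u + (log ((u : ℂ) / 2) + Real.eulerMascheroniConstant))
      (𝓝[>] 0) (𝓝 0) := by
  have hb : ∀ᶠ u : ℝ in 𝓝[>] 0, ‖gaussPow (1 / 2) u
      + (log ((u : ℂ) / 2) + Real.eulerMascheroniConstant)‖
      ≤ 2 * (√(2 * u) * ∫ r in Ioi (0 : ℝ), Real.exp (-r ^ 2)) := by
    filter_upwards [self_mem_nhdsWithin] with u hu
    have hu' : (0 : ℝ) < u := hu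
    obtain ⟨-, h1, h2⟩ := integral_logAddSqrt_bounds (a := 2 * u) (by positivity)
    rw [gaussPow_half_ofReal hu, integral_exp_neg_sq_div_sqrt (by positivity), log_half_ofReal hu,
      ← ofReal_add, ← ofReal_add, norm_real, Real.norm_eq_abs, abs_le,
      Real.log_mul two_ne_zero hu'.ne', Real.log_div hu'.ne' two_ne_zero]
    constructor <;> nlinarith [Real.sqrt_nonneg (2 * u)]
  refine squeeze_zero_norm' hb ?_
  have : Continuous fun u : ℝ => 2 * (√(2 * u) * ∫ r in Ioi (0 : ℝ), Real.exp (-r ^ 2)) := by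
    fun_prop
  have := (this.tendsto 0).mono_left (nhdsWithin_le_nhds (s := Ioi (0 : ℝ)))
  simpa using this

theorem tendsto_besselK_zero :
    Tendsto (fun u : ℝ => besselK u + (log ((u : ℂ) / 2) + Real.eulerMascheroniConstant))
      (𝓝[>] 0) (𝓝 0) := by
  have h1 := tendsto_log_half_mul_zero (h := fun _ => 1) continuous_const
  have h2 : Tendsto (fun u : ℝ => (log ((u : ℂ) / 2) + Real.eulerMascheroniConstant)
      * (1 - cexp (-u))) (𝓝[>] 0) (𝓝 0) := by
    refine squeeze_zero_norm' ?_ (tendsto_zero_iff_norm_tendsto_zero.1 h1)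
    filter_upwards [self_mem_nhdsWithin] with u hu
    have hu' : (0 : ℝ) < u := hu
    rw [norm_mul, norm_mul, mul_one, norm_real, Real.norm_of_nonneg hu'.le]
    gcongr
    rw [show (1 : ℂ) - cexp (-u) = ((1 - Real.exp (-u) : ℝ) : ℂ) by push_cast; ring, norm_real,
      Real.norm_eq_abs, abs_le]
    constructor
    · linarith [Real.exp_le_one_iff.2 (neg_nonpos.2 hu'.le)]
    · linarith [Real.add_one_le_exp (-u)]
  have h3 : Tendsto (fun u : ℝ => cexp (-u)) (𝓝[>] 0) (𝓝 1) := by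
    have : Continuous fun u : ℝ => cexp (-u) := by fun_prop
    have := (this.tendsto 0).mono_left (nhdsWithin_le_nhds (s := Ioi (0 : ℝ)))
    simpa using this
  have h4 := (h3.mul tendsto_gaussPow_zero).add h2
  rw [mul_zero, add_zero] at h4
  refine h4.congr fun u => ?_
  rw [besselK]; ring

theorem besselK_eq_besselKSeries {z : ℂ} (hz : z ∈ slitPlane) : besselK z = besselKSeries z :=
  isModifiedBesselPair_besselK.eq_besselKSeries tendsto_besselK_zero hz

/-! ### `K₀` at infinity along a ray -/

theorem mul_ofReal_mem_slitPlane {z : ℂ} (hz : z ∈ slitPlane) {u : ℝ} (hu : 0 < u) :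
    z * u ∈ slitPlane := by
  rw [mem_slitPlane_iff] at hz ⊢
  simp only [mul_re, mul_im, ofReal_re, ofReal_im, mul_zero, sub_zero, zero_add]
  rcases hz with h | h
  · exact Or.inl (by positivity)
  · exact Or.inr (mul_ne_zero h hu.ne')

theorem ofReal_mul_cpow {u : ℝ} (hu : 0 < u) {w : ℂ} (hw : w ≠ 0) (s : ℂ) :
    ((u : ℂ) * w) ^ s = (u : ℂ) ^ s * w ^ s := by
  have hu' : (u : ℂ) ≠ 0 := ofReal_ne_zero.2 hu.ne'
  rw [cpow_def_of_ne_zero (mul_ne_zero hu' hw), cpow_def_of_ne_zero hu', cpow_def_of_ne_zero hw,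
    log_ofReal_mul hu hw, ofReal_log hu.le, add_mul, exp_add]

/-- `√u e^{zu} K₀(zu)`, which is bounded in `u > 0` and converges as `u → ∞`. -/
noncomputable def scaledBesselK (z : ℂ) (u : ℝ) : ℂ := (√u : ℂ) * gaussPow (1 / 2) (z * u)

/-- Pulling the positive factor `u` out of the power cancels `√u` and leaves `u` only inside
`(r/√u)²`, which makes both the uniform bound and the limit immediate. -/
theorem scaledBesselK_eq {z : ℂ} (hz : z ∈ slitPlane) {u : ℝ} (hu : 0 < u) :
    scaledBesselK z u = ∫ r : ℝ, (Real.exp (-r ^ 2) : ℂ) *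
      ((((r / √u) ^ 2 : ℝ) : ℂ) + 2 * z) ^ ((-(1 / 2) : ℝ) : ℂ) := by
  rw [scaledBesselK, gaussPow, ← integral_const_mul]
  congr 1; funext r
  have h1 : (((r ^ 2 : ℝ) : ℂ) + 2 * (z * u))
      = (u : ℂ) * ((((r / √u) ^ 2 : ℝ) : ℂ) + 2 * z) := by
    rw [div_pow, Real.sq_sqrt hu.le]
    have : (u : ℂ) ≠ 0 := ofReal_ne_zero.2 hu.ne'
    push_cast; field_simp
  have h2 : (√u : ℂ) * (u : ℂ) ^ ((-(1 / 2) : ℝ) : ℂ) = 1 := by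
    rw [← ofReal_cpow hu.le, ← ofReal_mul, Real.rpow_neg hu.le, ← Real.sqrt_eq_rpow,
      mul_inv_cancel₀ (Real.sqrt_pos.2 hu).ne', ofReal_one]
  rw [gaussPowKernel, h1, ofReal_mul_cpow hu (slitPlane_ne_zero (add_sq_mem_slitPlane hz _))]
  linear_combination (Real.exp (-r ^ 2) : ℂ) *
    ((((r / √u) ^ 2 : ℝ) : ℂ) + 2 * z) ^ ((-(1 / 2) : ℝ) : ℂ) * h2

theorem exists_norm_scaledBesselK_le {z : ℂ} (hz : z ∈ slitPlane) :
    ∃ C, ∀ u : ℝ, 0 < u → ‖scaledBesselK z u‖ ≤ C := by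
  obtain ⟨ε, hε, h⟩ := exists_ball_le_norm_add_sq hz
  refine ⟨∫ r : ℝ, Real.exp (-r ^ 2) * ε ^ (-(1 / 2) : ℝ), fun u hu => ?_⟩
  rw [scaledBesselK_eq hz hu]
  refine norm_integral_le_of_norm_le (integrable_exp_neg_sq.mul_const _)
    (Eventually.of_forall fun r => ?_)
  rw [norm_mul, norm_real, Real.norm_of_nonneg (Real.exp_pos _).le, norm_cpow_real]
  exact mul_le_mul_of_nonneg_left (Real.rpow_le_rpow_of_nonpos hε
    ((h z (Metric.mem_ball_self hε)).2 _) (by norm_num)) (Real.exp_pos _).le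

theorem tendsto_scaledBesselK {z : ℂ} (hz : z ∈ slitPlane) :
    Tendsto (scaledBesselK z) atTop (𝓝 ((√Real.pi : ℂ) * (2 * z) ^ ((-(1 / 2) : ℝ) : ℂ))) := by
  obtain ⟨ε, hε, h⟩ := exists_ball_le_norm_add_sq hz
  have hlim : ∫ r : ℝ, (Real.exp (-r ^ 2) : ℂ) * (2 * z) ^ ((-(1 / 2) : ℝ) : ℂ)
      = (√Real.pi : ℂ) * (2 * z) ^ ((-(1 / 2) : ℝ) : ℂ) := by
    rw [integral_mul_const, integral_complex_ofReal]
    have := integral_gaussian 1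
    simp only [neg_mul, one_mul, div_one] at this
    rw [this]
  rw [← hlim]
  have key : Tendsto (fun u : ℝ => ∫ r : ℝ, (Real.exp (-r ^ 2) : ℂ) *
      ((((r / √u) ^ 2 : ℝ) : ℂ) + 2 * z) ^ ((-(1 / 2) : ℝ) : ℂ)) atTop
      (𝓝 (∫ r : ℝ, (Real.exp (-r ^ 2) : ℂ) * (2 * z) ^ ((-(1 / 2) : ℝ) : ℂ))) := by
    refine tendsto_integral_filter_of_dominated_convergence
      (fun r => Real.exp (-r ^ 2) * ε ^ (-(1 / 2) : ℝ)) ?_ ?_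
      (integrable_exp_neg_sq.mul_const _) (Eventually.of_forall fun r => ?_)
    · refine Eventually.of_forall fun u => Continuous.aestronglyMeasurable ?_
      refine Continuous.mul (by fun_prop) ?_
      exact continuous_iff_continuousAt.2 fun r => ContinuousAt.cpow (by fun_prop) (by fun_prop)
        (add_sq_mem_slitPlane hz (r / √u))
    · refine Eventually.of_forall fun u => Eventually.of_forall fun r => ?_
      rw [norm_mul, norm_real, Real.norm_of_nonneg (Real.exp_pos _).le, norm_cpow_real]
      exact mul_le_mul_of_nonneg_left (Real.rpow_le_rpow_of_nonpos hε
        ((h z (Metric.mem_ball_self hε)).2 _) (by norm_num)) (Real.exp_pos _).le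
    · refine Tendsto.const_mul _ ?_
      have h2z : 2 * z ∈ slitPlane := by simpa using add_sq_mem_slitPlane hz 0
      have h1 : Tendsto (fun u : ℝ => (((r / √u) ^ 2 : ℝ) : ℂ) + 2 * z) atTop (𝓝 (2 * z)) := by
        have : Tendsto (fun u : ℝ => (r / √u) ^ 2) atTop (𝓝 (0 ^ 2)) :=
          (tendsto_const_nhds.div_atTop Real.tendsto_sqrt_atTop).pow 2
        have := ((continuous_ofReal.tendsto _).comp this).add_const (2 * z)
        simpa using this
      exact (continuousAt_cpow_const h2z).tendsto.comp h1
  refine key.congr' ?_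
  filter_upwards [eventually_gt_atTop 0] with u hu
  exact (scaledBesselK_eq hz hu).symm

theorem scaledBesselK_limit_ne_zero {z : ℂ} (hz : z ∈ slitPlane) :
    (√Real.pi : ℂ) * (2 * z) ^ ((-(1 / 2) : ℝ) : ℂ) ≠ 0 := by
  refine mul_ne_zero (ofReal_ne_zero.2 (Real.sqrt_pos.2 Real.pi_pos).ne') ?_
  rw [Ne, cpow_eq_zero_iff]
  exact fun h => slitPlane_ne_zero hz (by simpa using h.1)

theorem continuousOn_scaledBesselK {z : ℂ} (hz : z ∈ slitPlane) :
    ContinuousOn (scaledBesselK z) (Ioi 0) := by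
  intro u hu
  have h1 := (hasDerivAt_gaussPow (a := 1 / 2) (by norm_num)
    (mul_ofReal_mem_slitPlane hz hu)).continuousAt
  have h2 : ContinuousAt (fun u : ℝ => gaussPow (1 / 2) (z * u)) u :=
    ContinuousAt.comp (f := fun u : ℝ => z * (u : ℂ)) h1 (by fun_prop)
  exact (ContinuousAt.mul (by fun_prop) h2).continuousWithinAt

theorem besselK_eq_scaled {z : ℂ} {u : ℝ} (hu : 0 < u) :
    besselK (z * u) = exp (-(z * u)) * scaledBesselK z u / (√u : ℂ) := by
  have : (√u : ℂ) ≠ 0 := ofReal_ne_zero.2 (Real.sqrt_pos.2 hu).ne'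
  rw [besselK, scaledBesselK]; field_simp

/-! ### Laplace's method for the Gamma mean -/

/-- The density of `√t - √n` for `t` Gamma distributed, without its normalizing constant. -/
noncomputable def rootGammaWeight (n : ℕ) (s : ℝ) : ℝ :=
  (Ioi (-√n)).indicator (fun s => (1 + s / √n) ^ (2 * n) * √(1 + s / √n)
    * Real.exp (-(2 * √n * s) - s ^ 2)) s

theorem rootGammaWeight_eq {n : ℕ} (hn : 1 ≤ n) {s : ℝ} (hs : -√n < s) :
    rootGammaWeight n s = √(1 + s / √n)
      * Real.exp (2 * n * (Real.log (1 + s / √n) - s / √n) - s ^ 2) := by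
  have hn' : (0 : ℝ) < √n := Real.sqrt_pos.2 (by exact_mod_cast hn)
  have hx : 0 < 1 + s / √n := by
    rw [show 1 + s / √n = (√n + s) / √n by field_simp]
    exact div_pos (by linarith) hn'
  have h1 : (1 + s / √n) ^ (2 * n) = Real.exp (2 * n * Real.log (1 + s / √n)) := by
    rw [← Real.exp_log (pow_pos hx _), Real.log_pow]; push_cast; rfl
  have h2 : 2 * √n * s = 2 * n * (s / √n) := by
    have : (n : ℝ) = √n * √n := (Real.mul_self_sqrt (Nat.cast_nonneg n)).symm
    field_simp
    nlinarith
  rw [rootGammaWeight, indicator_of_mem (show s ∈ Ioi (-√n) from hs), h1, h2,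
    show 2 * n * (Real.log (1 + s / √n) - s / √n) - s ^ 2
      = 2 * n * Real.log (1 + s / √n) + (-(2 * n * (s / √n)) - s ^ 2) by ring, Real.exp_add]
  ring

theorem rootGammaWeight_of_le {n : ℕ} {s : ℝ} (hs : s ≤ -√n) : rootGammaWeight n s = 0 :=
  indicator_of_notMem (by simpa using hs) _

/-- Since `log (1 + x) ≤ x`, the `n`-dependent exponent only helps. This gives a majorant
independent of `n`. -/
theorem rootGammaWeight_bounds {n : ℕ} (hn : 1 ≤ n) (s : ℝ) :
    0 ≤ rootGammaWeight n s ∧ rootGammaWeight n s ≤ (1 + |s|) * Real.exp (-s ^ 2) := by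
  rcases le_or_gt s (-√n) with h | h
  · rw [rootGammaWeight_of_le h]; exact ⟨le_rfl, by positivity⟩
  rw [rootGammaWeight_eq hn h]
  refine ⟨by positivity, ?_⟩
  have h1n : (1 : ℝ) ≤ √n := Real.one_le_sqrt.2 (by exact_mod_cast hn)
  have hx : 0 < 1 + s / √n := by
    rw [show 1 + s / √n = (√n + s) / √n by field_simp]
    exact div_pos (by linarith) (by linarith)
  have h2 : s / √n ≤ |s| := by
    calc s / √n ≤ |s| / √n := by gcongr; exact le_abs_self s
      _ ≤ |s| := div_le_self (abs_nonneg s) h1n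
  have h3 : √(1 + s / √n) ≤ 1 + |s| := by
    rw [Real.sqrt_le_left (by positivity)]
    nlinarith [abs_nonneg s]
  have h4 := Real.log_le_sub_one_of_pos hx
  gcongr
  have : 0 ≤ (2 * n : ℝ) * (s / √n - Real.log (1 + s / √n)) := by
    apply mul_nonneg (by positivity); linarith
  linarith

/-- With `x = s/√n` one has `2n (log (1 + x) - x) → -s²`, which doubles the explicit Gaussian
exponent `-s²`. -/
theorem tendsto_rootGammaWeight (s : ℝ) :
    Tendsto (fun n : ℕ => rootGammaWeight n s) atTop (𝓝 (Real.exp (-2 * s ^ 2))) := by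
  have hsq : Tendsto (fun n : ℕ => √(n : ℝ)) atTop atTop :=
    Real.tendsto_sqrt_atTop.comp tendsto_natCast_atTop_atTop
  have hx : Tendsto (fun n : ℕ => s / √(n : ℝ)) atTop (𝓝 0) := tendsto_const_nhds.div_atTop hsq
  have hlog : Tendsto (fun n : ℕ => 2 * (n : ℝ) * (Real.log (1 + s / √n) - s / √n)) atTop
      (𝓝 (-s ^ 2)) := by
    rw [tendsto_iff_norm_sub_tendsto_zero]
    have hb : Tendsto (fun n : ℕ => 4 * s ^ 2 * |s / √(n : ℝ)|) atTop (𝓝 0) := by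
      have := (hx.abs.const_mul (4 * s ^ 2))
      simpa using this
    refine squeeze_zero' (Eventually.of_forall fun _ => norm_nonneg _) ?_ hb
    filter_upwards [eventually_ge_atTop 1,
      hx.abs.eventually (eventually_le_nhds (show |(0 : ℝ)| < 1 / 2 by norm_num))] with n hn hxn
    have hn' : (0 : ℝ) < √n := Real.sqrt_pos.2 (by exact_mod_cast hn)
    set x := s / √(n : ℝ) with hxdef
    have hnx : (n : ℝ) * x ^ 2 = s ^ 2 := by
      rw [hxdef, div_pow, Real.sq_sqrt (Nat.cast_nonneg n)]
      have : (n : ℝ) ≠ 0 := by exact_mod_cast (by omega : n ≠ 0)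
      field_simp
    -- Second-order Taylor expansion with cubic remainder; `n x² = s²` turns `n |x|³` into `s² |x|`,
    -- which tends to zero.
    have h1 := Real.abs_log_sub_add_sum_range_le (x := -x) (by rw [abs_neg]; linarith) 2
    simp only [Finset.sum_range_succ, Finset.sum_range_zero, abs_neg, sub_neg_eq_add] at h1
    norm_num at h1
    have h2 : |x| ^ 3 / (1 - |x|) ≤ 2 * |x| ^ 3 := by
      rw [div_le_iff₀ (by linarith)]
      nlinarith [pow_nonneg (abs_nonneg x) 3]
    rw [Real.norm_eq_abs, show 2 * (n : ℝ) * (Real.log (1 + x) - x) - -s ^ 2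
      = 2 * n * (-x + x ^ 2 / 2 + Real.log (1 + x)) by rw [← hnx]; ring, abs_mul,
      abs_of_nonneg (by positivity : (0 : ℝ) ≤ 2 * n)]
    calc 2 * (n : ℝ) * |-x + x ^ 2 / 2 + Real.log (1 + x)| ≤ 2 * n * (2 * |x| ^ 3) := by
          gcongr; exact h1.trans h2
      _ = 4 * s ^ 2 * |x| := by rw [← hnx, ← sq_abs x]; ring
  have h1 : Tendsto (fun n : ℕ => √(1 + s / √(n : ℝ))
      * Real.exp (2 * n * (Real.log (1 + s / √n) - s / √n) - s ^ 2)) atTop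
      (𝓝 (√(1 + 0) * Real.exp (-s ^ 2 - s ^ 2))) :=
    ((Real.continuous_sqrt.tendsto _).comp (hx.const_add 1)).mul
      ((Real.continuous_exp.tendsto _).comp (hlog.sub_const _))
  rw [add_zero, Real.sqrt_one, one_mul, show -s ^ 2 - s ^ 2 = -2 * s ^ 2 by ring] at h1
  refine h1.congr' ?_
  filter_upwards [eventually_ge_atTop 1, hsq.eventually_gt_atTop (-s)] with n hn hs
  exact (rootGammaWeight_eq hn (by linarith)).symm

theorem measurable_rootGammaWeight (n : ℕ) : Measurable (rootGammaWeight n) :=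
  Measurable.indicator (by fun_prop) measurableSet_Ioi

theorem integrable_exp_mul_abs_sub_sq (c : ℝ) :
    Integrable fun s : ℝ => Real.exp (c * |s| - s ^ 2) := by
  have h1 : Integrable fun s : ℝ => Real.exp (c ^ 2 / 2) * Real.exp (-(1 / 2) * s ^ 2) :=
    (integrable_exp_neg_mul_sq (by norm_num)).const_mul _
  refine h1.mono' (by fun_prop) (Eventually.of_forall fun s => ?_)
  rw [Real.norm_of_nonneg (Real.exp_pos _).le, ← Real.exp_add]
  refine Real.exp_le_exp.2 ?_
  nlinarith [sq_nonneg (c - |s|), sq_abs s]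

/-- Laplace's method for `∫ rootGammaWeight n s · e^{-zs} q(√n + s) ds`. -/
theorem tendsto_integral_rootGammaWeight {q : ℝ → ℂ} {C : ℝ} {l : ℂ} (z : ℂ)
    (hq : ContinuousOn q (Ioi 0)) (hC : ∀ u, 0 < u → ‖q u‖ ≤ C) (hl : Tendsto q atTop (𝓝 l)) :
    Tendsto (fun n : ℕ => ∫ s : ℝ, (rootGammaWeight n s : ℂ) * (exp (-(z * s)) * q (√n + s)))
      atTop (𝓝 (l * ((√(Real.pi / 2) : ℂ) * exp (z ^ 2 / 8)))) := by
  have hC0 : 0 ≤ C := (norm_nonneg _).trans (hC 1 one_pos)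
  have hsq : Tendsto (fun n : ℕ => √(n : ℝ)) atTop atTop :=
    Real.tendsto_sqrt_atTop.comp tendsto_natCast_atTop_atTop
  have hlim : ∫ s : ℝ, (Real.exp (-2 * s ^ 2) : ℂ) * (exp (-(z * s)) * l)
      = l * ((√(Real.pi / 2) : ℂ) * exp (z ^ 2 / 8)) := by
    -- Completing the square in `-2s² - zs` produces the factor `e^{z²/8}`.
    have h := integral_cexp_quadratic (b := -2) (by norm_num) (-z) 0
    have e : ∀ s : ℝ, (Real.exp (-2 * s ^ 2) : ℂ) * (exp (-(z * s)) * l)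
        = l * exp (-2 * (s : ℂ) ^ 2 + -z * s + 0) := by
      intro s
      rw [exp_add, exp_add, exp_zero]; push_cast; ring_nf
    simp_rw [e]
    rw [integral_const_mul, h]
    congr 2
    · rw [neg_neg, Real.sqrt_eq_rpow, ofReal_cpow (by positivity)]
      push_cast; rfl
    · congr 1; ring
  rw [← hlim]
  refine tendsto_integral_filter_of_dominated_convergence
    (fun s => C * Real.exp ((1 + ‖z‖) * |s| - s ^ 2)) ?_ ?_
    ((integrable_exp_mul_abs_sub_sq _).const_mul C) (Eventually.of_forall fun s => ?_)
  · refine Eventually.of_forall fun n => ?_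
    have e : (fun s : ℝ => (rootGammaWeight n s : ℂ) * (exp (-(z * s)) * q (√n + s)))
        = (Ioi (-√n)).indicator
          (fun s : ℝ => (rootGammaWeight n s : ℂ) * (exp (-(z * s)) * q (√n + s))) := by
      funext s
      by_cases hs : s ∈ Ioi (-√(n : ℝ))
      · rw [indicator_of_mem hs]
      · rw [indicator_of_notMem hs, rootGammaWeight_of_le (by simpa using hs)]; simp
    rw [e, aestronglyMeasurable_indicator_iff measurableSet_Ioi]
    refine (measurable_ofReal.comp (measurable_rootGammaWeight n)).aestronglyMeasurable.mul ?_
    refine ContinuousOn.aestronglyMeasurable (ContinuousOn.mul (by fun_prop) ?_) measurableSet_Ioi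
    refine hq.comp (by fun_prop) fun s hs => ?_
    have : -√(n : ℝ) < s := hs
    show (0 : ℝ) < _
    linarith
  · filter_upwards [eventually_ge_atTop 1] with n hn
    refine Eventually.of_forall fun s => ?_
    rcases le_or_gt s (-√(n : ℝ)) with hs | hs
    · rw [rootGammaWeight_of_le hs]
      simpa using mul_nonneg hC0 (Real.exp_pos _).le
    obtain ⟨h0, h1⟩ := rootGammaWeight_bounds hn s
    rw [norm_mul, norm_mul, norm_real, Real.norm_of_nonneg h0, norm_exp]
    have h2 : (-(z * s)).re ≤ ‖z‖ * |s| := by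
      calc (-(z * s)).re ≤ ‖-(z * (s : ℂ))‖ := re_le_norm _
        _ = ‖z‖ * |s| := by rw [norm_neg, norm_mul, norm_real, Real.norm_eq_abs]
    have h3 : 1 + |s| ≤ Real.exp |s| := by linarith [Real.add_one_le_exp |s|]
    calc rootGammaWeight n s * (Real.exp (-(z * s)).re * ‖q (√n + s)‖)
        ≤ (Real.exp |s| * Real.exp (-s ^ 2)) * (Real.exp (‖z‖ * |s|) * C) := by
          gcongr
          · exact h1.trans (by gcongr)
          · exact hC _ (by linarith)
      _ = C * Real.exp ((1 + ‖z‖) * |s| - s ^ 2) := by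
          rw [show (1 + ‖z‖) * |s| - s ^ 2 = |s| + (-s ^ 2 + ‖z‖ * |s|) by ring, Real.exp_add,
            Real.exp_add]
          ring
  · exact ((continuous_ofReal.tendsto _).comp (tendsto_rootGammaWeight s)).mul
      ((hl.comp (tendsto_atTop_add_const_right _ s hsq)).const_mul _)

/-- `(1/n!) ∫₀^∞ e^{-t} t^n K₀(z √t) dt`. -/
noncomputable def gammaMean (z : ℂ) (n : ℕ) : ℂ :=
  (∫ t in Ioi (0 : ℝ), ((Real.exp (-t) * t ^ n : ℝ) : ℂ) * besselK (z * (√t : ℝ))) / (n.factorial : ℂ)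

theorem gammaMean_eq {z : ℂ} {n : ℕ} (hn : 1 ≤ n) :
    gammaMean z n = ((2 * (n : ℝ) ^ n * √n * Real.exp (-n) / n.factorial : ℝ) : ℂ)
      * (exp (-(z * (√n : ℝ))) / (√√n : ℂ))
      * ∫ s : ℝ, (rootGammaWeight n s : ℂ) * (exp (-(z * s)) * scaledBesselK z (√n + s)) := by
  have hn' : (0 : ℝ) < √n := Real.sqrt_pos.2 (by exact_mod_cast hn)
  -- The substitution is `t = u²` followed by `u = s + √n`. Of the factor `2u`, one `√u` is used up
  -- by the prefactor of `K₀`; the other gives the `√(1 + s/√n)` of the weight.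
  set f : ℝ → ℂ := fun u => ((2 * u * (Real.exp (-u ^ 2) * (u ^ 2) ^ n) : ℝ) : ℂ) * besselK (z * u)
    with hf
  have h1 : ∫ t in Ioi (0 : ℝ), ((Real.exp (-t) * t ^ n : ℝ) : ℂ) * besselK (z * (√t : ℝ))
      = ∫ u in Ioi (0 : ℝ), f u := by
    rw [← integral_comp_rpow_Ioi_of_pos
      (g := fun t => ((Real.exp (-t) * t ^ n : ℝ) : ℂ) * besselK (z * (√t : ℝ))) two_pos]
    refine setIntegral_congr_fun measurableSet_Ioi fun u hu => ?_
    have hu' : (0 : ℝ) < u := hu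
    simp only [hf]
    rw [show (2 : ℝ) - 1 = 1 by norm_num, Real.rpow_one, Real.rpow_two, Real.sqrt_sq hu'.le,
      real_smul]
    push_cast; ring
  have h2 : ∫ u in Ioi (0 : ℝ), f u = ∫ s : ℝ, (Ioi (0 : ℝ)).indicator f (s + √n) := by
    rw [← integral_indicator measurableSet_Ioi, integral_add_right_eq_self]
  have h3 : ∀ s : ℝ, (Ioi (0 : ℝ)).indicator f (s + √n)
      = ((2 * (n : ℝ) ^ n * √n * Real.exp (-n) : ℝ) : ℂ) * (exp (-(z * (√n : ℝ))) / (√√n : ℂ))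
        * ((rootGammaWeight n s : ℂ) * (exp (-(z * s)) * scaledBesselK z (√n + s))) := by
    intro s
    rcases le_or_gt s (-√(n : ℝ)) with hs | hs
    · rw [rootGammaWeight_of_le hs, indicator_of_notMem]
      · simp
      · show ¬ (0 : ℝ) < _
        linarith
    have hu : 0 < s + √n := by linarith
    have hx : 0 < 1 + s / √n := by
      rw [show 1 + s / √n = (√n + s) / √n by field_simp]
      exact div_pos (by linarith) (by linarith)
    have e1 : s + √n = √n * (1 + s / √n) := by field_simp; ring
    have e2 : √(s + √n) = √√n * √(1 + s / √n) := by rw [e1, Real.sqrt_mul hn'.le]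
    have e3 : ((s + √n) ^ 2) ^ n = (n : ℝ) ^ n * (1 + s / √n) ^ (2 * n) := by
      rw [e1, mul_pow, Real.sq_sqrt (Nat.cast_nonneg n), mul_pow, ← pow_mul]
    have e4 : Real.exp (-(s + √n) ^ 2) = Real.exp (-n) * Real.exp (-(2 * √n * s) - s ^ 2) := by
      rw [← Real.exp_add]
      congr 1
      nlinarith [Real.mul_self_sqrt (Nat.cast_nonneg (α := ℝ) n)]
    have e5 : exp (-(z * ((s + √n : ℝ) : ℂ))) = exp (-(z * (√n : ℝ))) * exp (-(z * s)) := by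
      rw [← exp_add]; congr 1; push_cast; ring
    have e6 : s + √n = √(s + √n) * √(s + √n) := (Real.mul_self_sqrt hu.le).symm
    have n1 : (√√n : ℂ) ≠ 0 := ofReal_ne_zero.2 (Real.sqrt_pos.2 hn').ne'
    have n2 : (√(1 + s / √n) : ℂ) ≠ 0 := ofReal_ne_zero.2 (Real.sqrt_pos.2 hx).ne'
    rw [indicator_of_mem (show s + √n ∈ Ioi (0 : ℝ) from hu), hf]
    simp only
    rw [besselK_eq_scaled hu, e5, e4, e3, e2, rootGammaWeight,
      indicator_of_mem (show s ∈ Ioi (-√(n : ℝ)) from hs)]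
    have e7 : ((s + √n : ℝ) : ℂ) = (√√n : ℂ) * (√√n : ℂ) * ((√(1 + s / √n) : ℂ) * (√(1 + s / √n) : ℂ)) := by
      rw [e6, e2]; push_cast; ring
    have e8 : ((√n : ℝ) : ℂ) = (√√n : ℂ) * (√√n : ℂ) := by
      rw [← ofReal_mul, Real.mul_self_sqrt hn'.le]
    rw [add_comm (√(n : ℝ)) s]
    simp only [ofReal_mul, e7]
    generalize scaledBesselK z (s + √n) = w
    generalize exp (-(z * s)) = w2
    generalize exp (-(z * (√n : ℝ))) = w3
    rw [show ((√n : ℝ) : ℂ) = (√√n : ℂ) * (√√n : ℂ) from e8]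
    field_simp
  rw [gammaMean, h1, h2, integral_congr_ae (Eventually.of_forall h3), integral_const_mul]
  push_cast; ring

/-- The factor equals `√2 / stirlingSeq n`. Its limit is the reciprocal of the Gaussian constant
`√(π/2)`, so the two cancel in the Gamma mean. -/
theorem tendsto_stirling_factor :
    Tendsto (fun n : ℕ => 2 * (n : ℝ) ^ n * √n * Real.exp (-n) / n.factorial) atTop
      (𝓝 (√(Real.pi / 2))⁻¹) := by
  have h := (Stirling.tendsto_stirlingSeq_sqrt_pi.inv₀ (Real.sqrt_pos.2 Real.pi_pos).ne').const_mul √2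
  have e : √2 * (√Real.pi)⁻¹ = (√(Real.pi / 2))⁻¹ := by
    rw [Real.sqrt_div Real.pi_pos.le, inv_div]; rfl
  rw [e] at h
  refine h.congr' ?_
  filter_upwards [eventually_ge_atTop 1] with n hn
  have hn' : (n : ℝ) ≠ 0 := by exact_mod_cast (by omega : n ≠ 0)
  have h2 : √2 * √2 = (2 : ℝ) := Real.mul_self_sqrt (by norm_num)
  have h3 : √n * √n = (n : ℝ) := Real.mul_self_sqrt (Nat.cast_nonneg n)
  have h4 : √(n : ℝ) ≠ 0 := fun h => by rw [h] at h3; simp at h3; exact hn' h3.symm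
  have h5 : √(2 : ℝ) ≠ 0 := by positivity
  have h6 : (n.factorial : ℝ) ≠ 0 := by positivity
  rw [Stirling.stirlingSeq, Real.sqrt_mul (by norm_num), div_pow,
    ← Real.exp_nat_mul, mul_one, Real.exp_neg]
  field_simp
  nlinarith

/-- `gammaMean z n ~ e^{z²/8} K₀(z √n)`. -/
theorem tendsto_gammaMean_div {z : ℂ} (hz : z ∈ slitPlane) :
    (∀ᶠ n : ℕ in atTop, besselK (z * (√n : ℝ)) ≠ 0) ∧
    Tendsto (fun n : ℕ => gammaMean z n / besselK (z * (√n : ℝ))) atTop (𝓝 (exp (z ^ 2 / 8))) := by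
  obtain ⟨C, hC⟩ := exists_norm_scaledBesselK_le hz
  have hl := tendsto_scaledBesselK hz
  have hl0 := scaledBesselK_limit_ne_zero hz
  set l := (√Real.pi : ℂ) * (2 * z) ^ ((-(1 / 2) : ℝ) : ℂ)
  have hsq : Tendsto (fun n : ℕ => √(n : ℝ)) atTop atTop :=
    Real.tendsto_sqrt_atTop.comp tendsto_natCast_atTop_atTop
  have hln := hl.comp hsq
  have hint := tendsto_integral_rootGammaWeight z (continuousOn_scaledBesselK hz) hC hl
  have hne : ∀ᶠ n : ℕ in atTop, scaledBesselK z √n ≠ 0 := hln.eventually_ne hl0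
  have hpos : ∀ᶠ n : ℕ in atTop, (0 : ℝ) < √n := hsq.eventually_gt_atTop 0
  constructor
  · filter_upwards [hne, hpos] with n h1 h2
    rw [besselK_eq_scaled h2]
    exact div_ne_zero (mul_ne_zero (exp_ne_zero _) h1)
      (ofReal_ne_zero.2 (Real.sqrt_pos.2 h2).ne')
  · have hs := (continuous_ofReal.tendsto _).comp tendsto_stirling_factor
    have h := (hs.mul hint).div hln hl0
    have hp : (√(Real.pi / 2) : ℂ) ≠ 0 := ofReal_ne_zero.2 (Real.sqrt_pos.2 (by positivity)).ne'
    have e : (((√(Real.pi / 2))⁻¹ : ℝ) : ℂ) * (l * ((√(Real.pi / 2) : ℂ) * exp (z ^ 2 / 8))) / l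
        = exp (z ^ 2 / 8) := by
      rw [ofReal_inv]; field_simp
    rw [e] at h
    refine h.congr' ?_
    filter_upwards [hne, hpos, eventually_ge_atTop 1] with n h1 h2 h3
    have n1 : (√√n : ℂ) ≠ 0 := ofReal_ne_zero.2 (Real.sqrt_pos.2 h2).ne'
    have n2 := exp_ne_zero (-(z * (√n : ℝ)))
    rw [besselK_eq_scaled h2, gammaMean_eq h3]
    simp only [Function.comp_apply, Pi.div_apply]
    field_simp

/-! ### Moment sums as solutions of the difference equation -/

/-- The moments `y^k (n+k)! / (k!² n!)` of the terms of `∑ (y t)^k / k!²`. -/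
noncomputable def momentCoeff (y : ℂ) (n k : ℕ) : ℂ :=
  y ^ k * ((n + k).factorial : ℂ) / ((k.factorial : ℂ) ^ 2 * (n.factorial : ℂ))

/-- The moments of the logarithmic part. -/
noncomputable def logMomentCoeff (y : ℂ) (n k : ℕ) : ℂ :=
  momentCoeff y n k * (((harmonic (n + k) : ℚ) : ℂ) - 2 * ((harmonic k : ℚ) : ℂ))

theorem factorial_add_le (n k : ℕ) :
    ((n + k).factorial : ℝ) ≤ 2 ^ n * n.factorial * 2 ^ k * k.factorial := by
  have h1 := Nat.add_choose_mul_factorial_mul_factorial n k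
  have h2 := Nat.choose_le_two_pow (n + k) k
  have : (n + k).factorial ≤ 2 ^ (n + k) * n.factorial * k.factorial := by
    rw [← h1]; gcongr
  calc ((n + k).factorial : ℝ) ≤ 2 ^ (n + k) * n.factorial * k.factorial := by exact_mod_cast this
    _ = _ := by rw [pow_add]; ring

theorem norm_momentCoeff_le (y : ℂ) (n k : ℕ) :
    ‖momentCoeff y n k‖ ≤ 2 ^ n * ((2 * ‖y‖) ^ k / k.factorial) := by
  have hk : (0 : ℝ) < k.factorial := by exact_mod_cast k.factorial_pos
  have hn : (0 : ℝ) < n.factorial := by exact_mod_cast n.factorial_pos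
  rw [momentCoeff, norm_div, norm_mul, norm_mul, norm_pow, norm_pow, Complex.norm_natCast,
    Complex.norm_natCast, Complex.norm_natCast, div_le_iff₀ (by positivity)]
  calc ‖y‖ ^ k * ((n + k).factorial : ℝ)
      ≤ ‖y‖ ^ k * (2 ^ n * n.factorial * 2 ^ k * k.factorial) := by
        gcongr; exact factorial_add_le n k
    _ = _ := by rw [mul_pow]; field_simp

theorem summable_momentCoeff (y : ℂ) (n : ℕ) : Summable (momentCoeff y n) :=
  Summable.of_norm_bounded ((Real.summable_pow_div_factorial (2 * ‖y‖)).mul_left (2 ^ n))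
    (norm_momentCoeff_le y n)

theorem summable_logMomentCoeff (y : ℂ) (n : ℕ) : Summable (logMomentCoeff y n) := by
  refine Summable.of_norm_bounded
    ((Real.summable_pow_div_factorial (4 * ‖y‖)).mul_left (2 ^ n * (3 * 2 ^ n))) fun k => ?_
  have h1 : ‖((harmonic (n + k) : ℚ) : ℂ) - 2 * ((harmonic k : ℚ) : ℂ)‖ ≤ 3 * 2 ^ n * 2 ^ k := by
    refine (norm_sub_le _ _).trans ?_
    rw [norm_mul, norm_harmonic, norm_harmonic, norm_ofNat]
    have h2 := harmonic_le_two_pow (n + k)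
    have h3 := harmonic_le_two_pow k
    rw [pow_add] at h2
    have h4 : (1 : ℝ) ≤ 2 ^ n := one_le_pow₀ (by norm_num)
    nlinarith [pow_pos (two_pos (α := ℝ)) k]
  rw [logMomentCoeff, norm_mul]
  calc _ ≤ 2 ^ n * ((2 * ‖y‖) ^ k / k.factorial) * (3 * 2 ^ n * 2 ^ k) := by
        gcongr; exact norm_momentCoeff_le y n k
    _ = _ := by rw [show 4 * ‖y‖ = 2 * ‖y‖ * 2 by ring, mul_pow (2 * ‖y‖) 2]; ring

/-- `∑_k momentCoeff y n k`. -/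
noncomputable def momentSum (y : ℂ) (n : ℕ) : ℂ := ∑' k, momentCoeff y n k

/-- `∑_k logMomentCoeff y n k`. -/
noncomputable def logMomentSum (y : ℂ) (n : ℕ) : ℂ := ∑' k, logMomentCoeff y n k

/-- The recurrence holds termwise after a shift: the `k + 1` term on the left matches the `k` term
on the right, and the left term at zero vanishes. -/
theorem tsum_three_term {a : ℕ → ℕ → ℂ} (ha : ∀ n, Summable (a n)) (y : ℂ) (m : ℕ)
    (h0 : ((m : ℂ) + 2) * (a (m + 2) 0 - a (m + 1) 0) - ((m : ℂ) + 1) * (a (m + 1) 0 - a m 0) = 0)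
    (h1 : ∀ k, ((m : ℂ) + 2) * (a (m + 2) (k + 1) - a (m + 1) (k + 1))
      - ((m : ℂ) + 1) * (a (m + 1) (k + 1) - a m (k + 1)) = y * a (m + 1) k) :
    ((m : ℂ) + 2) * (∑' k, a (m + 2) k - ∑' k, a (m + 1) k)
      - ((m : ℂ) + 1) * (∑' k, a (m + 1) k - ∑' k, a m k) = y * ∑' k, a (m + 1) k := by
  have s2 := (((ha (m + 2)).sub (ha (m + 1))).mul_left ((m : ℂ) + 2)).sub
    (((ha (m + 1)).sub (ha m)).mul_left ((m : ℂ) + 1))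
  rw [← (ha (m + 2)).tsum_sub (ha (m + 1)), ← (ha (m + 1)).tsum_sub (ha m), ← tsum_mul_left,
    ← tsum_mul_left, ← Summable.tsum_sub (((ha (m + 2)).sub (ha (m + 1))).mul_left _)
    (((ha (m + 1)).sub (ha m)).mul_left _), s2.tsum_eq_zero_add, h0, zero_add, ← tsum_mul_left]
  exact tsum_congr h1

/-- The same shift for the step from `n = 0` to `n = 1`, where the eigenvalue equation is not
imposed. The defect `e` is `0` for the moments and `1` for the logarithmic moments, which separates
`Phi` from `Psi`. -/
theorem tsum_first_term {a : ℕ → ℕ → ℂ} (ha : ∀ n, Summable (a n)) (y e : ℂ)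
    (h0 : a 1 0 - a 0 0 = e) (h1 : ∀ k, a 1 (k + 1) - a 0 (k + 1) = y * a 0 k) :
    ∑' k, a 1 k = e + (1 + y) * ∑' k, a 0 k := by
  have h : ∑' k, a 1 k - ∑' k, a 0 k = e + y * ∑' k, a 0 k := by
    rw [← (ha 1).tsum_sub (ha 0), ((ha 1).sub (ha 0)).tsum_eq_zero_add, h0, ← tsum_mul_left]
    congr 1
    exact tsum_congr h1
  linear_combination h

theorem momentCoeff_zero (y : ℂ) (n : ℕ) : momentCoeff y n 0 = 1 := by
  have := factorial_cast_ne_zero n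
  simp [momentCoeff, this]

/-- Neighbouring values of `momentCoeff` as polynomial multiples of a common factor. -/
theorem momentCoeff_relations (y : ℂ) (m k : ℕ) :
    ∃ q : ℂ, momentCoeff y m (k + 1) = ((m : ℂ) + 1) * y * q ∧
      momentCoeff y (m + 1) (k + 1) = ((m : ℂ) + k + 2) * y * q ∧
      ((m : ℂ) + 2) * momentCoeff y (m + 2) (k + 1) = ((m : ℂ) + k + 3) * ((m : ℂ) + k + 2) * y * q ∧
      momentCoeff y (m + 1) k = ((k : ℂ) + 1) ^ 2 * q := by
  refine ⟨y ^ k * ((m + 1 + k).factorial : ℂ) / (((k + 1).factorial : ℂ) ^ 2 * ((m + 1).factorial : ℂ)),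
    ?_, ?_, ?_, ?_⟩
  all_goals
    have n1 := factorial_cast_ne_zero m
    have n2 := factorial_cast_ne_zero k
    have n3 := natCast_succ_ne_zero m
    have n4 := natCast_succ_ne_zero k
    have n5 : (m : ℂ) + 2 ≠ 0 := by exact_mod_cast (by omega : m + 2 ≠ 0)
    have n6 : (m : ℂ) + 1 + 1 ≠ 0 := by exact_mod_cast (by omega : m + 1 + 1 ≠ 0)
    simp only [momentCoeff, show m + (k + 1) = m + 1 + k by ring,
      show m + 1 + (k + 1) = m + 1 + k + 1 by ring, show m + 2 + (k + 1) = m + 1 + k + 1 + 1 by ring,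
      show m + 2 = m + 1 + 1 by ring]
    simp only [factorial_succ_cast]
    push_cast
    field_simp
    try ring

theorem momentCoeff_first (y : ℂ) (k : ℕ) :
    ∃ q : ℂ, momentCoeff y 0 (k + 1) = y * q ∧ momentCoeff y 1 (k + 1) = ((k : ℂ) + 2) * y * q ∧
      momentCoeff y 0 k = ((k : ℂ) + 1) * q := by
  refine ⟨y ^ k / ((k + 1).factorial : ℂ), ?_, ?_, ?_⟩
  all_goals
    have n2 := factorial_cast_ne_zero k
    have n4 := natCast_succ_ne_zero k
    simp only [momentCoeff, zero_add, show 1 + (k + 1) = k + 1 + 1 by ring, Nat.factorial_zero,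
      Nat.factorial_one]
    simp only [factorial_succ_cast]
    push_cast
    field_simp
    try ring

theorem momentSum_recurrence (y : ℂ) (m : ℕ) :
    ((m : ℂ) + 2) * (momentSum y (m + 2) - momentSum y (m + 1))
      - ((m : ℂ) + 1) * (momentSum y (m + 1) - momentSum y m) = y * momentSum y (m + 1) := by
  refine tsum_three_term (summable_momentCoeff y) y m (by simp [momentCoeff_zero]) fun k => ?_
  obtain ⟨q, h1, h2, h3, h4⟩ := momentCoeff_relations y m k
  linear_combination h3 - ((m : ℂ) + 2 + (m + 1)) * h2 + ((m : ℂ) + 1) * h1 - y * h4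

theorem momentSum_one (y : ℂ) : momentSum y 1 = (1 + y) * momentSum y 0 := by
  have := tsum_first_term (summable_momentCoeff y) y 0 (by simp [momentCoeff_zero]) fun k => by
    obtain ⟨q, h1, h2, h3⟩ := momentCoeff_first y k
    rw [h1, h2, h3]; ring
  rw [zero_add] at this
  exact this

theorem logMomentSum_recurrence (y : ℂ) (m : ℕ) :
    ((m : ℂ) + 2) * (logMomentSum y (m + 2) - logMomentSum y (m + 1))
      - ((m : ℂ) + 1) * (logMomentSum y (m + 1) - logMomentSum y m)
      = y * logMomentSum y (m + 1) := by
  have n3 := natCast_succ_ne_zero m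
  have n6 : (m : ℂ) + 1 + 1 ≠ 0 := by exact_mod_cast (by omega : m + 1 + 1 ≠ 0)
  refine tsum_three_term (summable_logMomentCoeff y) y m ?_ fun k => ?_
  · simp only [logMomentCoeff, momentCoeff_zero, add_zero, harmonic_succ_cast]
    push_cast
    field_simp
    ring
  · obtain ⟨q, h1, h2, h3, h4⟩ := momentCoeff_relations y m k
    have n4 := natCast_succ_ne_zero k
    have n7 : (m : ℂ) + 1 + k + 1 ≠ 0 := by exact_mod_cast (by omega : m + 1 + k + 1 ≠ 0)
    have n8 : (m : ℂ) + 1 + k + 1 + 1 ≠ 0 := by exact_mod_cast (by omega : m + 1 + k + 1 + 1 ≠ 0)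
    simp only [logMomentCoeff, h1, h2, h4, show m + (k + 1) = m + 1 + k by ring,
      show m + 1 + (k + 1) = m + 1 + k + 1 by ring, show m + 2 + (k + 1) = m + 1 + k + 1 + 1 by ring]
    simp only [harmonic_succ_cast (m + 1 + k + 1), harmonic_succ_cast (m + 1 + k),
      harmonic_succ_cast k]
    generalize ((harmonic (m + 1 + k) : ℚ) : ℂ) = A
    generalize ((harmonic k : ℚ) : ℂ) = B
    push_cast
    have key : ((m : ℂ) + 2) * (momentCoeff y (m + 2) (k + 1) *
        (A + 1 / ((m : ℂ) + 1 + k + 1) + 1 / ((m : ℂ) + 1 + k + 1 + 1) - 2 * (B + 1 / ((k : ℂ) + 1))))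
        = ((m : ℂ) + k + 3) * ((m : ℂ) + k + 2) * y * q *
        (A + 1 / ((m : ℂ) + 1 + k + 1) + 1 / ((m : ℂ) + 1 + k + 1 + 1) - 2 * (B + 1 / ((k : ℂ) + 1))) := by
      rw [← h3]; ring
    have n1 : 1 / ((m : ℂ) + 1 + k + 1) * ((m : ℂ) + k + 2) = 1 := by
      rw [show (m : ℂ) + k + 2 = (m : ℂ) + 1 + k + 1 by ring]; field_simp
    have n2 : 1 / ((m : ℂ) + 1 + k + 1 + 1) * ((m : ℂ) + k + 3) = 1 := by
      rw [show (m : ℂ) + k + 3 = (m : ℂ) + 1 + k + 1 + 1 by ring]; field_simp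
    have n5 : 1 / ((k : ℂ) + 1) * ((k : ℂ) + 1) = 1 := by field_simp
    generalize 1 / ((m : ℂ) + 1 + k + 1) = a at *
    generalize 1 / ((m : ℂ) + 1 + k + 1 + 1) = b at *
    generalize 1 / ((k : ℂ) + 1) = c at *
    -- The increments of the harmonic numbers contribute `(k - m) + (m + k + 2) - 2(k + 1) = 0`; the
    -- rest is the recurrence without logarithm.
    linear_combination key + y * q * (m + k + 3 - (m + 2 + (m + 1))) * n1 + y * q * (m + k + 2) * n2
      - 2 * y * q * (k + 1) * n5

theorem logMomentSum_one (y : ℂ) : logMomentSum y 1 = 1 + (1 + y) * logMomentSum y 0 := by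
  refine tsum_first_term (summable_logMomentCoeff y) y 1 ?_ fun k => ?_
  · simp [logMomentCoeff, momentCoeff_zero, harmonic_succ]
  · obtain ⟨q, h1, h2, h3⟩ := momentCoeff_first y k
    have n4 := natCast_succ_ne_zero k
    have n5 : (k : ℂ) + 1 + 1 ≠ 0 := by exact_mod_cast (by omega : k + 1 + 1 ≠ 0)
    simp only [logMomentCoeff, h1, h2, h3, zero_add, show 1 + (k + 1) = k + 1 + 1 by ring]
    simp only [harmonic_succ_cast]
    push_cast
    field_simp
    ring

theorem isEigensequence_of_recurrence {κ : ℂ} {l : ℕ → ℂ}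
    (h : ∀ m : ℕ, ((m : ℂ) + 2) * (l (m + 2) - l (m + 1)) - ((m : ℂ) + 1) * (l (m + 1) - l m)
      = -κ * l (m + 1)) : IsEigensequence κ l := by
  intro n hn
  obtain ⟨m, rfl⟩ : ∃ m, n = m + 1 := ⟨n - 1, by omega⟩
  have := h m
  simp only [opA, Nat.add_sub_cancel, show m + 1 + 1 = m + 2 by ring]
  push_cast
  linear_combination -this

theorem momentSum_zero (κ : ℂ) : momentSum (-κ) 0 = exp (-κ) := by
  rw [momentSum, exp_eq_exp_ℂ, NormedSpace.exp_eq_tsum_div]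
  refine tsum_congr fun k => ?_
  have := factorial_cast_ne_zero k
  simp only [momentCoeff, zero_add, Nat.factorial_zero]
  push_cast; field_simp

theorem logMomentSum_zero (κ : ℂ) : logMomentSum (-κ) 0
    = -∑' s : ℕ, (-κ) ^ s / (s.factorial : ℂ) * ((harmonic s : ℚ) : ℂ) := by
  rw [logMomentSum, ← tsum_neg]
  refine tsum_congr fun k => ?_
  have := factorial_cast_ne_zero k
  simp only [logMomentCoeff, momentCoeff, zero_add, Nat.factorial_zero]
  push_cast; field_simp; ring

theorem Phi_eq (κ : ℂ) (n : ℕ) : Phi κ n = exp κ * momentSum (-κ) n := by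
  have h : IsEigensequence κ fun n => exp κ * momentSum (-κ) n :=
    isEigensequence_of_recurrence fun m => by
      linear_combination exp κ * momentSum_recurrence (-κ) m
  have h0 : exp κ * momentSum (-κ) 0 = 1 := by rw [momentSum_zero, ← exp_add]; simp
  have h1 : exp κ * momentSum (-κ) 1 = 1 - κ := by
    rw [momentSum_one]; linear_combination (1 - κ) * h0
  have := congrFun (eigensolution_unique h) n
  simp only [h0, h1] at this
  rw [this, Phi]

/-- `F` is designed so that `F κ + γ + log κ` is the multiple of `momentSum` that makes the value at
`0` vanish. The value at `1` is then `1` by the defect of `logMomentSum`. -/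
theorem Psi_eq (κ : ℂ) (n : ℕ) : Psi κ n = logMomentSum (-κ) n
    + (F κ + Real.eulerMascheroniConstant + log κ) * momentSum (-κ) n := by
  set a := F κ + Real.eulerMascheroniConstant + log κ with ha
  have h : IsEigensequence κ fun n => logMomentSum (-κ) n + a * momentSum (-κ) n :=
    isEigensequence_of_recurrence fun m => by
      linear_combination logMomentSum_recurrence (-κ) m + a * momentSum_recurrence (-κ) m
  have h0 : logMomentSum (-κ) 0 + a * momentSum (-κ) 0 = 0 := by
    have e : exp κ * exp (-κ) = 1 := by rw [← exp_add]; simp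
    rw [momentSum_zero, logMomentSum_zero, ha, F]
    linear_combination (∑' s : ℕ, (-κ) ^ s / (s.factorial : ℂ) * ((harmonic s : ℚ) : ℂ)) * e
  have h1 : logMomentSum (-κ) 1 + a * momentSum (-κ) 1 = 1 := by
    rw [momentSum_one, logMomentSum_one]; linear_combination (1 - κ) * h0
  have := congrFun (eigensolution_unique h) n
  simp only [h0, h1] at this
  rw [this, Psi]

/-! ### Termwise integration of the expansion of `K₀` -/

theorem integrableOn_const_mul_ofReal {f : ℝ → ℝ} (hf : IntegrableOn f (Ioi 0)) (A : ℂ) :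
    IntegrableOn (fun t : ℝ => A * (f t : ℂ)) (Ioi 0) :=
  (Integrable.ofReal hf).const_mul A

/-- The terms of the expansion of `e^{-t} t^n K₀(z √t)`. -/
noncomputable def gammaMeanTerm (A B : ℂ) (m : ℕ) (t : ℝ) : ℂ :=
  A * ((Real.exp (-t) * t ^ m : ℝ) : ℂ) + B * ((Real.exp (-t) * t ^ m * Real.log t : ℝ) : ℂ)

theorem gammaMeanTerm_integral (A B : ℂ) (m : ℕ) :
    IntegrableOn (gammaMeanTerm A B m) (Ioi 0) ∧
    ∫ t in Ioi (0 : ℝ), gammaMeanTerm A B m t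
      = A * m.factorial + B * (m.factorial * (((harmonic m : ℚ) : ℂ) - Real.eulerMascheroniConstant)) ∧
    ∫ t in Ioi (0 : ℝ), ‖gammaMeanTerm A B m t‖
      ≤ ‖A‖ * m.factorial + ‖B‖ * (3 * (m + 1).factorial) := by
  obtain ⟨i1, e1⟩ := integral_exp_neg_mul_pow m
  obtain ⟨i2, e2⟩ := integral_exp_neg_mul_pow_mul_log m
  obtain ⟨i3, e3⟩ := integral_exp_neg_mul_pow (m + 1)
  have j1 := integrableOn_const_mul_ofReal i1 A
  have j2 := integrableOn_const_mul_ofReal i2 B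
  have hI : IntegrableOn (gammaMeanTerm A B m) (Ioi 0) := j1.add j2
  refine ⟨hI, ?_, ?_⟩
  · simp only [gammaMeanTerm]
    rw [integral_add j1 j2, integral_const_mul, integral_const_mul, integral_complex_ofReal,
      integral_complex_ofReal, e1, e2]
    push_cast; ring
  · have hb : IntegrableOn (fun t : ℝ => ‖A‖ * (Real.exp (-t) * t ^ m)
        + ‖B‖ * (2 * (Real.exp (-t) * t ^ (m + 1)) - Real.exp (-t) * t ^ m * Real.log t)) (Ioi 0) :=
      (i1.const_mul _).add (((i3.const_mul 2).sub i2).const_mul _)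
    have hle : ∀ t ∈ Ioi (0 : ℝ), ‖gammaMeanTerm A B m t‖ ≤ ‖A‖ * (Real.exp (-t) * t ^ m)
        + ‖B‖ * (2 * (Real.exp (-t) * t ^ (m + 1)) - Real.exp (-t) * t ^ m * Real.log t) := by
      intro t ht
      have ht' : (0 : ℝ) < t := ht
      refine (norm_add_le _ _).trans ?_
      rw [norm_mul, norm_mul, norm_real, norm_real, Real.norm_of_nonneg (by positivity),
        norm_mul, Real.norm_of_nonneg (by positivity), Real.norm_eq_abs]
      gcongr
      calc Real.exp (-t) * t ^ m * |Real.log t|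
          ≤ Real.exp (-t) * t ^ m * (2 * t - Real.log t) := by gcongr; exact abs_log_le t ht
        _ = _ := by rw [pow_succ]; ring
    refine (setIntegral_mono_on hI.norm hb measurableSet_Ioi hle).trans ?_
    have hsub : IntegrableOn (fun t : ℝ => 2 * (Real.exp (-t) * t ^ (m + 1))
        - Real.exp (-t) * t ^ m * Real.log t) (Ioi 0) := (i3.const_mul 2).sub i2
    rw [integral_add (i1.const_mul _) (hsub.const_mul _), integral_const_mul, integral_const_mul,
      integral_sub (i3.const_mul 2) i2, integral_const_mul, e1, e2, e3]
    -- The constant `3`: the integral of the majorant is `2 (m+1)! - m! (H_m - γ)`, and `H_m ≥ 0`,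
    -- `γ < 1`.
    have hγ := Real.eulerMascheroniConstant_lt_two_thirds
    have hH := harmonic_nonneg m
    have hf : (m.factorial : ℝ) ≤ (m + 1).factorial := by
      exact_mod_cast Nat.factorial_le (Nat.le_succ m)
    have hf0 : (0 : ℝ) ≤ m.factorial := by positivity
    gcongr
    nlinarith

theorem log_half_mul_sqrt {z : ℂ} (hz : z ≠ 0) {t : ℝ} (ht : 0 < t) :
    log (z * (√t : ℝ) / 2) = log (z / 2) + (Real.log t : ℂ) / 2 := by
  rw [show z * (√t : ℝ) / 2 = ((√t : ℝ) : ℂ) * (z / 2) by ring,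
    log_ofReal_mul (Real.sqrt_pos.2 ht) (div_ne_zero hz two_ne_zero), Real.log_sqrt ht.le]
  push_cast; ring

/-- The coefficient of `e^{-t} t^{n+k}` in the expansion of `e^{-t} t^n K₀(z √t)`. -/
noncomputable def besselKCoeff (z : ℂ) (k : ℕ) : ℂ :=
  (z ^ 2 / 4) ^ k / (k.factorial : ℂ) ^ 2
    * (((harmonic k : ℚ) : ℂ) - (log (z / 2) + Real.eulerMascheroniConstant))

/-- The coefficient of `e^{-t} t^{n+k} log t`. -/
noncomputable def besselKLogCoeff (z : ℂ) (k : ℕ) : ℂ :=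
  -(1 / 2) * ((z ^ 2 / 4) ^ k / (k.factorial : ℂ) ^ 2)

theorem tsum_gammaMeanTerm {z : ℂ} (hz : z ∈ slitPlane) (n : ℕ) {t : ℝ} (ht : 0 < t) :
    ∑' k, gammaMeanTerm (besselKCoeff z k) (besselKLogCoeff z k) (n + k) t
      = ((Real.exp (-t) * t ^ n : ℝ) : ℂ) * besselK (z * (√t : ℝ)) := by
  rw [besselK_eq_besselKSeries (mul_ofReal_mem_slitPlane hz (Real.sqrt_pos.2 ht)), besselKSeries,
    besselI, log_half_mul_sqrt (slitPlane_ne_zero hz) ht, seriesSum, seriesSum, ← tsum_mul_left,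
    ← ((entireCoeff_besselCoeff.summable _).mul_left _).tsum_add
      (entireCoeff_besselHarmonicCoeff.summable _), ← tsum_mul_left]
  refine tsum_congr fun k => ?_
  have e : (z * ((√t : ℝ) : ℂ)) ^ 2 / 4 = z ^ 2 / 4 * t := by
    rw [mul_pow, ← ofReal_pow, Real.sq_sqrt ht.le]; ring
  rw [e, mul_pow, gammaMeanTerm, besselKCoeff, besselKLogCoeff, besselCoeff, besselHarmonicCoeff]
  push_cast
  rw [pow_add]
  ring

theorem summable_gammaMeanTerm (z : ℂ) (n : ℕ) :
    Summable fun k : ℕ => ‖besselKCoeff z k‖ * (n + k).factorial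
      + ‖besselKLogCoeff z k‖ * (3 * (n + k + 1).factorial) := by
  set D := ‖log (z / 2) + Real.eulerMascheroniConstant‖
  set y := z ^ 2 / 4
  refine Summable.of_nonneg_of_le (fun k => by positivity) (fun k => ?_)
    ((Real.summable_pow_div_factorial (4 * ‖y‖)).mul_left
      ((1 + D) * (2 ^ n * n.factorial) + 1 / 2 * (3 * (2 ^ (n + 1) * (n + 1).factorial))))
  have hk : (0 : ℝ) < k.factorial := by exact_mod_cast k.factorial_pos
  have hD : 0 ≤ D := norm_nonneg _
  have h2k : (1 : ℝ) ≤ 2 ^ k := one_le_pow₀ (by norm_num)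
  have hA : ‖besselKCoeff z k‖ ≤ ‖y‖ ^ k / (k.factorial : ℝ) ^ 2 * ((1 + D) * 2 ^ k) := by
    rw [besselKCoeff, norm_mul, norm_div, norm_pow, norm_pow, Complex.norm_natCast]
    gcongr
    refine (norm_sub_le _ _).trans ?_
    rw [norm_harmonic]
    nlinarith [harmonic_le_two_pow k]
  have hB : ‖besselKLogCoeff z k‖ = 1 / 2 * (‖y‖ ^ k / (k.factorial : ℝ) ^ 2) := by
    rw [besselKLogCoeff, norm_mul, norm_div, norm_pow, norm_pow, Complex.norm_natCast,
      show ‖(-(1 / 2) : ℂ)‖ = 1 / 2 by norm_num]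
  have h1 := factorial_add_le n k
  have h2 := factorial_add_le (n + 1) k
  rw [show n + 1 + k = n + k + 1 by ring] at h2
  rw [hB]
  calc _ ≤ ‖y‖ ^ k / (k.factorial : ℝ) ^ 2 * ((1 + D) * 2 ^ k) * (2 ^ n * n.factorial * 2 ^ k * k.factorial)
        + 1 / 2 * (‖y‖ ^ k / (k.factorial : ℝ) ^ 2)
          * (3 * (2 ^ (n + 1) * (n + 1).factorial * 2 ^ k * k.factorial)) := by gcongr
    _ ≤ ‖y‖ ^ k / (k.factorial : ℝ) ^ 2 * ((1 + D) * 2 ^ k) * (2 ^ n * n.factorial * 2 ^ k * k.factorial)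
        + 1 / 2 * (‖y‖ ^ k / (k.factorial : ℝ) ^ 2)
          * (3 * (2 ^ (n + 1) * (n + 1).factorial * 2 ^ k * k.factorial)) * 2 ^ k :=
        add_le_add le_rfl (le_mul_of_one_le_right (by positivity) h2k)
    _ = _ := by
        rw [mul_pow, show (4 : ℝ) ^ k = 2 ^ k * 2 ^ k by rw [← mul_pow]; norm_num]
        field_simp

/-- The Gamma mean of `K₀(z √t)` through the moment sums. -/
theorem gammaMean_eq_momentSum {z : ℂ} (hz : z ∈ slitPlane) (n : ℕ) :
    gammaMean z n = -(1 / 2) * (logMomentSum (z ^ 2 / 4) n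
      + (Real.eulerMascheroniConstant + 2 * log (z / 2)) * momentSum (z ^ 2 / 4) n) := by
  -- Sum and integral are interchanged by summability of the integrals of the norms.
  have hs := hasSum_integral_of_summable_integral_norm (μ := volume.restrict (Ioi (0 : ℝ)))
    (F := fun k => gammaMeanTerm (besselKCoeff z k) (besselKLogCoeff z k) (n + k))
    (fun k => (gammaMeanTerm_integral _ _ _).1)
    (Summable.of_nonneg_of_le (fun k => by positivity)
      (fun k => (gammaMeanTerm_integral _ _ _).2.2) (summable_gammaMeanTerm z n))
  rw [setIntegral_congr_fun measurableSet_Ioi (fun t ht => tsum_gammaMeanTerm hz n ht)] at hs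
  rw [gammaMean, ← hs.tsum_eq, logMomentSum, momentSum, ← tsum_mul_left,
    ← (summable_logMomentCoeff _ n).tsum_add ((summable_momentCoeff _ n).mul_left _),
    ← tsum_mul_left, ← tsum_div_const]
  refine tsum_congr fun k => ?_
  rw [(gammaMeanTerm_integral _ _ _).2.1]
  have := factorial_cast_ne_zero n
  have := factorial_cast_ne_zero k
  simp only [besselKCoeff, besselKLogCoeff, logMomentCoeff, momentCoeff]
  field_simp
  ring

/-! ### Rotation by `∓i`: from `K₀` to `J₀` and `Y₀` -/

open Asymptotics

theorem log_neg_I_mul {w : ℂ} (hw : 0 < w.re) : log (-I * w) = log w - Real.pi / 2 * I := by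
  have h0 : w ≠ 0 := fun h => by simp [h] at hw
  have ha := abs_lt.1 (abs_arg_lt_pi_div_two_iff.2 (Or.inl hw))
  rw [log_mul (neg_ne_zero.2 I_ne_zero) h0, log_neg_I]
  · ring
  · rw [arg_neg_I]; constructor <;> linarith [Real.pi_pos]

theorem log_I_mul {w : ℂ} (hw : 0 < w.re) : log (I * w) = log w + Real.pi / 2 * I := by
  have h0 : w ≠ 0 := fun h => by simp [h] at hw
  have ha := abs_lt.1 (abs_arg_lt_pi_div_two_iff.2 (Or.inl hw))
  rw [log_mul I_ne_zero h0, log_I]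
  · ring
  · rw [arg_I]; constructor <;> linarith [Real.pi_pos]

theorem neg_I_mul_mem_slitPlane {w : ℂ} (hw : 0 < w.re) : -I * w ∈ slitPlane := by
  rw [mem_slitPlane_iff]; right; simp [hw.ne']

theorem I_mul_mem_slitPlane {w : ℂ} (hw : 0 < w.re) : I * w ∈ slitPlane := by
  rw [mem_slitPlane_iff]; right; simp [hw.ne']

theorem besselI_eq_besselJ0 {z x : ℂ} (h : z ^ 2 = -x ^ 2) : besselI z = besselJ0 x := by
  rw [besselI, besselJ0, h, seriesSum]
  exact tsum_congr fun k => by rw [besselCoeff]; ring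

theorem seriesSum_besselHarmonicCoeff_eq {z x : ℂ} (h : z ^ 2 = -x ^ 2) :
    seriesSum besselHarmonicCoeff (z ^ 2 / 4)
      = ∑' k : ℕ, (-x ^ 2 / 4) ^ k / ((k.factorial : ℂ) ^ 2) * ((harmonic k : ℚ) : ℂ) := by
  rw [h, seriesSum]
  exact tsum_congr fun k => by rw [besselHarmonicCoeff]; ring

theorem pi_cast_ne_zero : (Real.pi : ℂ) ≠ 0 := ofReal_ne_zero.2 Real.pi_pos.ne'

/-- The rotation turns `z²` into `-x²`, and the jump `-πi/2` of the logarithm supplies the `J₀` term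
next to `Y₀`: this is the Hankel function of the first kind. -/
theorem besselK_neg_I_mul {x : ℂ} (hx : 0 < x.re) :
    besselK (-I * x) = Real.pi / 2 * I * (besselJ0 x + I * besselY0 x) := by
  have h : (-I * x) ^ 2 = -x ^ 2 := by rw [mul_pow, neg_sq, I_sq]; ring
  have hx2 : 0 < (x / 2).re := by
    have : (x / 2).re = x.re / 2 := by simp
    rw [this]; positivity
  have hp := pi_cast_ne_zero
  rw [besselK_eq_besselKSeries (neg_I_mul_mem_slitPlane hx), besselKSeries,
    besselI_eq_besselJ0 h, seriesSum_besselHarmonicCoeff_eq h, besselY0, mul_div_assoc,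
    log_neg_I_mul hx2]
  generalize (∑' k : ℕ, (-x ^ 2 / 4) ^ k / ((k.factorial : ℂ) ^ 2) * ((harmonic k : ℚ) : ℂ)) = N
  field_simp
  linear_combination (-2 * (besselJ0 x * (log (x / 2) + Real.eulerMascheroniConstant) - N)) * I_sq

theorem besselK_I_mul {x : ℂ} (hx : 0 < x.re) :
    besselK (I * x) = -(Real.pi / 2 * I * (besselJ0 x - I * besselY0 x)) := by
  have h : (I * x) ^ 2 = -x ^ 2 := by rw [mul_pow, I_sq]; ring
  have hx2 : 0 < (x / 2).re := by
    have : (x / 2).re = x.re / 2 := by simp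
    rw [this]; positivity
  have hp := pi_cast_ne_zero
  rw [besselK_eq_besselKSeries (I_mul_mem_slitPlane hx), besselKSeries,
    besselI_eq_besselJ0 h, seriesSum_besselHarmonicCoeff_eq h, besselY0, mul_div_assoc,
    log_I_mul hx2]
  generalize (∑' k : ℕ, (-x ^ 2 / 4) ^ k / ((k.factorial : ℂ) ^ 2) * ((harmonic k : ℚ) : ℂ)) = N
  field_simp
  linear_combination (-2 * (besselJ0 x * (log (x / 2) + Real.eulerMascheroniConstant) - N)) * I_sq

/-- `√(4κ)`. -/
noncomputable def besselScale (κ : ℂ) : ℂ := Complex.sqrt (4 * κ)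

theorem besselScale_sq (κ : ℂ) : besselScale κ ^ 2 = 4 * κ := by
  rw [besselScale, Complex.sqrt]
  exact_mod_cast cpow_nat_inv_pow (4 * κ) two_ne_zero

theorem besselScale_re_pos {κ : ℂ} (hκ : 0 < κ.re) : 0 < (besselScale κ).re := by
  rw [besselScale, Complex.sqrt, cpow_inv_two_re]
  have : (4 * κ).re = 4 * κ.re := by simp
  rw [this]
  positivity

/-- Together with the positive real part, this shows that the imaginary part of `√(4κ)` has the sign
of `κ.im`. -/
theorem besselScale_im {κ : ℂ} : (besselScale κ).re * (besselScale κ).im = 2 * κ.im := by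
  have h := congrArg im (besselScale_sq κ)
  rw [sq] at h
  simp only [mul_im, re_ofNat, im_ofNat, zero_mul, add_zero] at h
  linarith

theorem besselArg_eq {κ : ℂ} (hκ : κ ≠ 0) {n : ℕ} (hn : 1 ≤ n) :
    besselArg κ n = besselScale κ * (√(n : ℝ) : ℝ) := by
  have hn' : (0 : ℝ) < n := by exact_mod_cast hn
  rw [besselArg, besselScale, Complex.sqrt, Complex.sqrt,
    show 4 * (n : ℂ) * κ = ((n : ℝ) : ℂ) * (4 * κ) by push_cast; ring,
    ofReal_mul_cpow hn' (mul_ne_zero (by norm_num) hκ), mul_comm, Real.sqrt_eq_rpow,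
    ofReal_cpow hn'.le]
  push_cast
  norm_num

theorem two_mul_log_besselScale {κ : ℂ} (hκ : 0 < κ.re) :
    2 * log (besselScale κ / 2) = log κ := by
  have hr := besselScale_re_pos hκ
  have hw : 0 < (besselScale κ / 2).re := by
    have : (besselScale κ / 2).re = (besselScale κ).re / 2 := by simp
    rw [this]; positivity
  have h0 : besselScale κ / 2 ≠ 0 := fun h => by simp [h] at hw
  have ha := abs_lt.1 (abs_arg_lt_pi_div_two_iff.2 (Or.inl hw))
  have h1 : κ = besselScale κ / 2 * (besselScale κ / 2) := by
    linear_combination (-1 / 4) * besselScale_sq κ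
  conv_rhs => rw [h1, log_mul h0 h0 (by constructor <;> linarith)]
  ring

/-! ### Sizes of the Hankel functions and non-decay of `Psi` -/

theorem isLittleO_gammaMean_sub {z : ℂ} (hz : z ∈ slitPlane) :
    (fun n : ℕ => gammaMean z n - exp (z ^ 2 / 8) * besselK (z * (√(n : ℝ) : ℝ)))
      =o[atTop] fun n : ℕ => besselK (z * (√(n : ℝ) : ℝ)) := by
  obtain ⟨h1, h2⟩ := tendsto_gammaMean_div hz
  rw [isLittleO_iff_tendsto' (h1.mono fun n hn h => absurd h hn)]
  have h3 := h2.sub_const (exp (z ^ 2 / 8))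
  rw [sub_self] at h3
  refine h3.congr' ?_
  filter_upwards [h1] with n hn
  field_simp

theorem tendsto_natCast_sqrt_atTop : Tendsto (fun n : ℕ => √(n : ℝ)) atTop atTop :=
  Real.tendsto_sqrt_atTop.comp tendsto_natCast_atTop_atTop

/-- The quotient is `e^{-(z-w)√n}` times a convergent factor. -/
theorem isLittleO_besselK_of_re_lt {z w : ℂ} (hz : z ∈ slitPlane) (hw : w ∈ slitPlane)
    (h : w.re < z.re) :
    (fun n : ℕ => besselK (z * (√(n : ℝ) : ℝ))) =o[atTop] fun n : ℕ => besselK (w * (√(n : ℝ) : ℝ)) := by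
  rw [isLittleO_iff_tendsto' ((tendsto_gammaMean_div hw).1.mono fun n hn h => absurd h hn)]
  have hexp : Tendsto (fun n : ℕ => exp (-((z - w) * (√(n : ℝ) : ℝ)))) atTop (𝓝 0) := by
    rw [tendsto_zero_iff_norm_tendsto_zero]
    simp only [norm_exp, neg_re, re_mul_ofReal, sub_re]
    exact Real.tendsto_exp_atBot.comp (tendsto_neg_atTop_atBot.comp
      (tendsto_natCast_sqrt_atTop.const_mul_atTop (sub_pos.2 h)))
  have hq := ((tendsto_scaledBesselK hz).div (tendsto_scaledBesselK hw)
    (scaledBesselK_limit_ne_zero hw)).comp tendsto_natCast_sqrt_atTop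
  have hm := hexp.mul hq
  rw [zero_mul] at hm
  refine hm.congr' ?_
  filter_upwards [tendsto_natCast_sqrt_atTop.eventually_gt_atTop 0] with n hn
  have n1 : (√√(n : ℝ) : ℂ) ≠ 0 := ofReal_ne_zero.2 (Real.sqrt_pos.2 hn).ne'
  rw [besselK_eq_scaled hn, besselK_eq_scaled hn, show -((z - w) * ((√(n : ℝ) : ℝ) : ℂ))
    = -(z * (√(n : ℝ) : ℝ)) - -(w * (√(n : ℝ) : ℝ)) by ring, exp_sub]
  have n2 := exp_ne_zero (-(w * ((√(n : ℝ) : ℝ) : ℂ)))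
  simp only [Function.comp_apply, Pi.div_apply]
  rw [div_div_div_cancel_right₀ n1, div_mul_div_comm]

/-- The factor `n` is included to match the weight `n + 1` of the Casoratian that rules out decay of
`Psi`. -/
theorem tendsto_natCast_mul_besselK {z : ℂ} (hz : z ∈ slitPlane) (h : 0 < z.re) :
    Tendsto (fun n : ℕ => (n : ℝ) * ‖besselK (z * (√(n : ℝ) : ℝ))‖) atTop (𝓝 0) := by
  obtain ⟨C, hC⟩ := exists_norm_scaledBesselK_le hz
  have h1 : Tendsto (fun n : ℕ => √(n : ℝ) ^ 2 * Real.exp (-z.re * √(n : ℝ))) atTop (𝓝 0) := by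
    have := (Real.tendsto_pow_mul_exp_neg_atTop_nhds_zero 2).comp
      (tendsto_natCast_sqrt_atTop.const_mul_atTop h)
    have h2 := this.const_mul ((z.re ^ 2)⁻¹)
    rw [mul_zero] at h2
    refine h2.congr fun n => ?_
    simp only [Function.comp_apply, mul_pow, neg_mul]
    field_simp
  have h2 := h1.mul_const C
  rw [zero_mul] at h2
  refine squeeze_zero' (Eventually.of_forall fun n => by positivity) ?_ h2
  filter_upwards [eventually_ge_atTop 1] with n hn
  have h1n : (1 : ℝ) ≤ √n := Real.one_le_sqrt.2 (by exact_mod_cast hn)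
  have h1m : (1 : ℝ) ≤ √√n := Real.one_le_sqrt.2 h1n
  rw [besselK_eq_scaled (by linarith), Real.sq_sqrt (Nat.cast_nonneg n), norm_div, norm_mul,
    norm_exp, norm_real, Real.norm_of_nonneg (Real.sqrt_nonneg _), neg_re, re_mul_ofReal, mul_assoc,
    neg_mul]
  gcongr
  refine (div_le_self (by positivity) h1m).trans ?_
  gcongr
  exact hC _ (by linarith)

/-- A solution with `λ 0 = 0` of the eigenvalue equation at non-real `κ` does not decay. -/
theorem not_tendsto_natCast_mul_Psi {κ : ℂ} (hκ : κ.im ≠ 0) :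
    ¬ Tendsto (fun n : ℕ => (n : ℝ) * ‖Psi κ n‖) atTop (𝓝 0) := by
  intro h
  obtain ⟨hrec, h0, h1⟩ := eigensolution_spec κ 0 1
  set l : ℕ → ℂ := Psi κ with hl
  have hrec : IsEigensequence κ l := hrec
  have h0 : l 0 = 0 := h0
  have h1 : l 1 = 1 := h1
  -- Up to a constant this is the weighted Casoratian of `l` and its conjugate. It would be
  -- conserved for real `κ`; here each step adds `-κ.im |l (n+1)|²`. Starting from `D 0 = 0`, all
  -- increments have one sign, and the first has size `|κ.im|`.
  let D : ℕ → ℝ := fun n => ((n : ℝ) + 1) * (l (n + 1) * (starRingEnd ℂ) (l n)).im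
  have hD : ∀ n, D (n + 1) = D n - κ.im * normSq (l (n + 1)) := by
    intro n
    have e := hrec (n + 1) (by omega)
    simp only [opA, Nat.add_sub_cancel] at e
    have er := congrArg re e
    have ei := congrArg im e
    simp at er ei
    simp only [D, mul_im, conj_re, conj_im, normSq_apply]
    push_cast
    linear_combination (l (n + 1)).im * er - (l (n + 1)).re * ei
  have hle : ∀ n, 1 ≤ n → |κ.im| ≤ |D n| := by
    have hsum : ∀ n, ∃ s : ℝ, 1 ≤ s ∧ D (n + 1) = -κ.im * s := by
      intro n
      induction n with
      | zero =>
        refine ⟨1, le_rfl, ?_⟩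
        rw [hD 0]; simp [D, h0, h1]
      | succ n ih =>
        obtain ⟨s, hs, e⟩ := ih
        refine ⟨s + normSq (l (n + 1 + 1)), by linarith [normSq_nonneg (l (n + 1 + 1))], ?_⟩
        rw [hD, e]; ring
    intro n hn
    obtain ⟨m, rfl⟩ : ∃ m, n = m + 1 := ⟨n - 1, by omega⟩
    obtain ⟨s, hs, e⟩ := hsum m
    rw [e, abs_mul, abs_neg]
    exact le_mul_of_one_le_right (abs_nonneg _) (hs.trans (le_abs_self s))
  have hl0 : Tendsto (fun n : ℕ => ‖l n‖) atTop (𝓝 0) := by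
    refine squeeze_zero' (Eventually.of_forall fun n => norm_nonneg _) ?_ h
    filter_upwards [eventually_ge_atTop 1] with n hn
    exact le_mul_of_one_le_left (norm_nonneg _) (by exact_mod_cast hn)
  have hlim : Tendsto (fun n => |D n|) atTop (𝓝 0) := by
    have h2 := ((tendsto_add_atTop_iff_nat 1).2 h).mul hl0
    rw [mul_zero] at h2
    refine squeeze_zero (fun n => abs_nonneg _) (fun n => ?_) h2
    simp only [D]
    rw [abs_mul, abs_of_nonneg (by positivity)]
    push_cast
    rw [mul_assoc]
    gcongr
    refine (abs_im_le_norm _).trans ?_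
    rw [norm_mul, RCLike.norm_conj]
  have := ge_of_tendsto hlim (eventually_atTop.2 ⟨1, hle⟩)
  exact hκ (abs_eq_zero.1 (le_antisymm this (abs_nonneg _)))

/-! ### `Phi` and `Psi` in terms of the two Hankel means -/

/-- The Gamma mean of `K₀(-i x)`. -/
noncomputable def hankelMean₁ (κ : ℂ) (n : ℕ) : ℂ := gammaMean (-I * besselScale κ) n

/-- The Gamma mean of `K₀(i x)`. -/
noncomputable def hankelMean₂ (κ : ℂ) (n : ℕ) : ℂ := gammaMean (I * besselScale κ) n

/-- `K₀(-i x(n, κ))`. -/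
noncomputable def hankel₁ (κ : ℂ) (n : ℕ) : ℂ := besselK (-I * besselScale κ * (√(n : ℝ) : ℝ))

/-- `K₀(i x(n, κ))`. -/
noncomputable def hankel₂ (κ : ℂ) (n : ℕ) : ℂ := besselK (I * besselScale κ * (√(n : ℝ) : ℝ))

section
variable {κ : ℂ}

theorem hankelMean₁_eq (hκ : 0 < κ.re) (n : ℕ) :
    hankelMean₁ κ n = -(1 / 2) * (logMomentSum (-κ) n
      + (Real.eulerMascheroniConstant + (log κ - Real.pi * I)) * momentSum (-κ) n) := by
  have hr := besselScale_re_pos hκ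
  have hw : 0 < (besselScale κ / 2).re := by
    have : (besselScale κ / 2).re = (besselScale κ).re / 2 := by simp
    rw [this]; positivity
  have e : (-I * besselScale κ) ^ 2 / 4 = -κ := by
    rw [mul_pow, besselScale_sq, neg_sq, I_sq]; ring
  rw [hankelMean₁, gammaMean_eq_momentSum (neg_I_mul_mem_slitPlane hr), e, mul_div_assoc,
    log_neg_I_mul hw, ← two_mul_log_besselScale hκ]
  ring

theorem hankelMean₂_eq (hκ : 0 < κ.re) (n : ℕ) :
    hankelMean₂ κ n = -(1 / 2) * (logMomentSum (-κ) n
      + (Real.eulerMascheroniConstant + (log κ + Real.pi * I)) * momentSum (-κ) n) := by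
  have hr := besselScale_re_pos hκ
  have hw : 0 < (besselScale κ / 2).re := by
    have : (besselScale κ / 2).re = (besselScale κ).re / 2 := by simp
    rw [this]; positivity
  have e : (I * besselScale κ) ^ 2 / 4 = -κ := by
    rw [mul_pow, besselScale_sq, I_sq]; ring
  rw [hankelMean₂, gammaMean_eq_momentSum (I_mul_mem_slitPlane hr), e, mul_div_assoc,
    log_I_mul hw, ← two_mul_log_besselScale hκ]
  ring

theorem pi_mul_I_ne_zero : (Real.pi : ℂ) * I ≠ 0 := mul_ne_zero pi_cast_ne_zero I_ne_zero

/-- The two means differ only in the branch of the logarithm, so their difference is `πi` times the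
moment sum. -/
theorem Phi_eq_hankelMean (hκ : 0 < κ.re) (n : ℕ) :
    Phi κ n = exp κ / (Real.pi * I) * hankelMean₁ κ n + -(exp κ / (Real.pi * I)) * hankelMean₂ κ n := by
  have := pi_mul_I_ne_zero
  rw [hankelMean₁_eq hκ, hankelMean₂_eq hκ, Phi_eq]
  generalize (Real.pi : ℂ) * I = p at *
  field_simp
  ring

/-- Minus the sum of the means averages the branches to `log κ`; the remaining multiple `F κ` of the
moment sum comes from their difference. -/
theorem Psi_eq_hankelMean (hκ : 0 < κ.re) (n : ℕ) :
    Psi κ n = (-1 + F κ / (Real.pi * I)) * hankelMean₁ κ n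
      + (-1 - F κ / (Real.pi * I)) * hankelMean₂ κ n := by
  have := pi_mul_I_ne_zero
  rw [hankelMean₁_eq hκ, hankelMean₂_eq hκ, Psi_eq]
  generalize (Real.pi : ℂ) * I = p at *
  field_simp
  ring

theorem hankel_eq (hκ : 0 < κ.re) {n : ℕ} (hn : 1 ≤ n) :
    hankel₁ κ n = Real.pi / 2 * I * (besselJ0 (besselArg κ n) + I * besselY0 (besselArg κ n)) ∧
    hankel₂ κ n = -(Real.pi / 2 * I * (besselJ0 (besselArg κ n) - I * besselY0 (besselArg κ n))) := by
  have hκ0 : κ ≠ 0 := fun h => by simp [h] at hκ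
  have hx : 0 < (besselArg κ n).re := by
    rw [besselArg_eq hκ0 hn, re_mul_ofReal]
    exact mul_pos (besselScale_re_pos hκ) (Real.sqrt_pos.2 (by exact_mod_cast hn))
  rw [hankel₁, hankel₂, mul_assoc (-I), mul_assoc I, ← besselArg_eq hκ0 hn]
  exact ⟨besselK_neg_I_mul hx, besselK_I_mul hx⟩

theorem exp_eq_mul_exp_neg_half : exp (κ / 2) = exp κ * exp (-κ / 2) := by
  rw [← exp_add]; ring_nf

theorem PhiAsym_eq (hκ : 0 < κ.re) {n : ℕ} (hn : 1 ≤ n) :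
    PhiAsym κ n = exp (-κ / 2) * (exp κ / (Real.pi * I) * hankel₁ κ n
      + -(exp κ / (Real.pi * I)) * hankel₂ κ n) := by
  have hp := pi_cast_ne_zero
  have hI := I_ne_zero
  obtain ⟨h1, h2⟩ := hankel_eq hκ hn
  rw [h1, h2, PhiAsym, exp_eq_mul_exp_neg_half]
  field_simp
  ring

theorem PsiAsym_eq (hκ : 0 < κ.re) {n : ℕ} (hn : 1 ≤ n) :
    PsiAsym κ n = exp (-κ / 2) * ((-1 + F κ / (Real.pi * I)) * hankel₁ κ n
      + (-1 - F κ / (Real.pi * I)) * hankel₂ κ n) := by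
  have hp := pi_cast_ne_zero
  have hI := I_ne_zero
  obtain ⟨h1, h2⟩ := hankel_eq hκ hn
  rw [h1, h2, PsiAsym]
  field_simp
  linear_combination (2 * Real.pi * besselY0 (besselArg κ n)) * I_sq

theorem isBigO_hankel (hκ : 0 < κ.re) :
    (hankel₁ κ =O[atTop] fun n : ℕ => besselSize κ n) ∧
    (hankel₂ κ =O[atTop] fun n : ℕ => besselSize κ n) := by
  have hs : ∀ n, ‖besselSize κ n‖ = besselSize κ n := fun n =>
    Real.norm_of_nonneg (by rw [besselSize]; positivity)
  have hpi : ‖(Real.pi : ℂ) / 2 * I‖ = Real.pi / 2 := by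
    rw [norm_mul, norm_I, norm_div, norm_real, Real.norm_of_nonneg Real.pi_pos.le]; norm_num
  constructor
  · refine IsBigO.of_bound (Real.pi / 2) ?_
    filter_upwards [eventually_ge_atTop 1] with n hn
    rw [(hankel_eq hκ hn).1, norm_mul, hpi, hs, besselSize]
    gcongr
    refine (norm_add_le _ _).trans (le_of_eq ?_)
    rw [norm_mul, norm_I, one_mul]
  · refine IsBigO.of_bound (Real.pi / 2) ?_
    filter_upwards [eventually_ge_atTop 1] with n hn
    rw [(hankel_eq hκ hn).2, norm_neg, norm_mul, hpi, hs, besselSize]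
    gcongr
    refine (norm_sub_le _ _).trans (le_of_eq ?_)
    rw [norm_mul, norm_I, one_mul]

theorem isLittleO_hankelMean (hκ : 0 < κ.re) :
    ((fun n => hankelMean₁ κ n - exp (-κ / 2) * hankel₁ κ n) =o[atTop] hankel₁ κ) ∧
    ((fun n => hankelMean₂ κ n - exp (-κ / 2) * hankel₂ κ n) =o[atTop] hankel₂ κ) := by
  have hr := besselScale_re_pos hκ
  have e1 : (-I * besselScale κ) ^ 2 / 8 = -κ / 2 := by
    rw [mul_pow, besselScale_sq, neg_sq, I_sq]; ring
  have e2 : (I * besselScale κ) ^ 2 / 8 = -κ / 2 := by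
    rw [mul_pow, besselScale_sq, I_sq]; ring
  have h1 := isLittleO_gammaMean_sub (neg_I_mul_mem_slitPlane hr)
  have h2 := isLittleO_gammaMean_sub (I_mul_mem_slitPlane hr)
  rw [e1] at h1
  rw [e2] at h2
  exact ⟨h1, h2⟩

end

theorem isLittleO_combination {T₁ T₂ A₁ A₂ : ℕ → ℂ} {s : ℕ → ℝ} {f g : ℕ → ℂ} {a b E : ℂ}
    (h₁ : (fun n => T₁ n - E * A₁ n) =o[atTop] A₁) (h₂ : (fun n => T₂ n - E * A₂ n) =o[atTop] A₂)
    (hs₁ : A₁ =O[atTop] s) (hs₂ : A₂ =O[atTop] s) (hf : ∀ n, f n = a * T₁ n + b * T₂ n)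
    (hg : ∀ n, 1 ≤ n → g n = E * (a * A₁ n + b * A₂ n)) :
    (fun n => f n - g n) =o[atTop] s := by
  refine (((h₁.trans_isBigO hs₁).const_mul_left a).add
    ((h₂.trans_isBigO hs₂).const_mul_left b)).congr' ?_ EventuallyEq.rfl
  filter_upwards [eventually_ge_atTop 1] with n hn
  rw [hf, hg n hn]; ring

/-- Both `f - g` and `g - E b A₂` are negligible against `A₂`, so `b ≠ 0` is what allows errors to
be measured by `g` itself. -/
theorem isEquivalent_combination {T₁ T₂ A₁ A₂ : ℕ → ℂ} {f g : ℕ → ℂ} {a b E : ℂ}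
    (h₁ : (fun n => T₁ n - E * A₁ n) =o[atTop] A₁) (h₂ : (fun n => T₂ n - E * A₂ n) =o[atTop] A₂)
    (h₁₂ : A₁ =o[atTop] A₂) (hf : ∀ n, f n = a * T₁ n + b * T₂ n)
    (hg : ∀ n, 1 ≤ n → g n = E * (a * A₁ n + b * A₂ n)) (hb : b ≠ 0) (hE : E ≠ 0) :
    IsEquivalent atTop f g := by
  have hfg : (fun n => f n - g n) =o[atTop] A₂ := by
    refine (((h₁.trans h₁₂).const_mul_left a).add (h₂.const_mul_left b)).congr' ?_ EventuallyEq.rfl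
    filter_upwards [eventually_ge_atTop 1] with n hn
    rw [hf, hg n hn]; ring
  have hgA : (fun n => g n - (E * b) * A₂ n) =o[atTop] fun n => (E * b) * A₂ n := by
    refine IsLittleO.trans_isBigO ?_ (isBigO_self_const_mul (mul_ne_zero hE hb) A₂ atTop)
    refine (h₁₂.const_mul_left (E * a)).congr' ?_ EventuallyEq.rfl
    filter_upwards [eventually_ge_atTop 1] with n hn
    rw [hg n hn]; ring
  have hequiv : IsEquivalent atTop g (fun n => (E * b) * A₂ n) := hgA
  exact hfg.trans_isBigO ((isBigO_self_const_mul (mul_ne_zero hE hb) A₂ atTop).trans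
    hequiv.isBigO_symm)

/-- If `Psi` had no dominant component it would decay. -/
theorem coeff_ne_zero_of_Psi_eq {κ : ℂ} (him : κ.im ≠ 0) {T A : ℕ → ℂ} {E a b : ℂ} {T' : ℕ → ℂ}
    (h : (fun n => T n - E * A n) =o[atTop] A) (hA : Tendsto (fun n : ℕ => (n : ℝ) * ‖A n‖) atTop (𝓝 0))
    (hPsi : ∀ n, Psi κ n = a * T n + b * T' n) : b ≠ 0 := by
  rintro rfl
  refine not_tendsto_natCast_mul_Psi him ?_
  have hT : T =O[atTop] A := by
    have := h.isBigO.add ((isBigO_refl A atTop).const_mul_left E)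
    simpa using this
  have hP : Psi κ =O[atTop] A := by
    refine (hT.const_mul_left a).congr_left fun n => ?_
    rw [hPsi]; ring
  have hO : (fun n : ℕ => (n : ℝ) * ‖Psi κ n‖) =O[atTop] fun n : ℕ => (n : ℝ) * ‖A n‖ :=
    (isBigO_refl _ _).mul hP.norm_norm
  exact hO.trans_tendsto hA

/-- Large-index asymptotics of `Phi` and `Psi`. -/
theorem isLittleO_and_isEquivalent_asym (κ : ℂ) (hκ : 0 < κ.re) :
    IsLittleO atTop
      (fun n : ℕ => Phi κ n - PhiAsym κ n)
      (fun n : ℕ => besselSize κ n) ∧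
    IsLittleO atTop
      (fun n : ℕ => Psi κ n - PsiAsym κ n)
      (fun n : ℕ => besselSize κ n) ∧
    (κ.im ≠ 0 →
      IsEquivalent atTop (Phi κ) (PhiAsym κ) ∧
      IsEquivalent atTop (Psi κ) (PsiAsym κ)) := by
  obtain ⟨h1, h2⟩ := isLittleO_hankelMean hκ
  obtain ⟨s1, s2⟩ := isBigO_hankel hκ
  have hr := besselScale_re_pos hκ
  have m1 := neg_I_mul_mem_slitPlane hr
  have m2 := I_mul_mem_slitPlane hr
  have hE : exp (-κ / 2) ≠ 0 := exp_ne_zero _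
  have hc : exp κ / (Real.pi * I) ≠ 0 :=
    div_ne_zero (exp_ne_zero _) pi_mul_I_ne_zero
  have re1 : (-I * besselScale κ).re = (besselScale κ).im := by simp
  have re2 : (I * besselScale κ).re = -(besselScale κ).im := by simp
  have him := besselScale_im (κ := κ)
  refine ⟨isLittleO_combination h1 h2 s1 s2 (Phi_eq_hankelMean hκ) fun n => PhiAsym_eq hκ,
    isLittleO_combination h1 h2 s1 s2 (Psi_eq_hankelMean hκ) fun n => PsiAsym_eq hκ, fun hi => ?_⟩
  -- The sign of `κ.im` decides which Hankel function grows: `hankel₁` for negative and `hankel₂`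
  -- for positive sign. The other one decays, as `coeff_ne_zero_of_Psi_eq` requires.
  rcases lt_or_gt_of_ne hi with hi' | hi'
  · have hneg : (besselScale κ).im < 0 := by
      by_contra h
      nlinarith [mul_nonneg hr.le (not_lt.1 h)]
    have h21 : hankel₂ κ =o[atTop] hankel₁ κ :=
      isLittleO_besselK_of_re_lt m2 m1 (by rw [re1, re2]; linarith)
    have hdec := tendsto_natCast_mul_besselK m2 (by rw [re2]; linarith)
    have hb := coeff_ne_zero_of_Psi_eq hi h2 hdec fun n => by
      rw [Psi_eq_hankelMean hκ, add_comm]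
    exact ⟨isEquivalent_combination h2 h1 h21
        (fun n => by rw [Phi_eq_hankelMean hκ, add_comm])
        (fun n hn => by rw [PhiAsym_eq hκ hn, add_comm]) hc hE,
      isEquivalent_combination h2 h1 h21
        (fun n => by rw [Psi_eq_hankelMean hκ, add_comm])
        (fun n hn => by rw [PsiAsym_eq hκ hn, add_comm]) hb hE⟩
  · have hpos : 0 < (besselScale κ).im := by
      by_contra h
      nlinarith [mul_nonneg hr.le (neg_nonneg.2 (not_lt.1 h))]
    have h12 : hankel₁ κ =o[atTop] hankel₂ κ :=
      isLittleO_besselK_of_re_lt m1 m2 (by rw [re1, re2]; linarith)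
    have hdec := tendsto_natCast_mul_besselK m1 (by rw [re1]; linarith)
    have hb := coeff_ne_zero_of_Psi_eq hi h1 hdec (Psi_eq_hankelMean hκ)
    exact ⟨isEquivalent_combination h1 h2 h12 (Phi_eq_hankelMean hκ) (fun n => PhiAsym_eq hκ)
        (neg_ne_zero.2 hc) hE,
      isEquivalent_combination h1 h2 h12 (Psi_eq_hankelMean hκ) (fun n => PsiAsym_eq hκ) hb hE⟩

end NCSoliton

theorem mainTheorem3 (κ : ℂ) (hκ : 0 < κ.re) :
    Asymptotics.IsLittleO Filter.atTop
      (fun n : ℕ => NCSoliton.Phi κ n - NCSoliton.PhiAsym κ n)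
      (fun n : ℕ => NCSoliton.besselSize κ n) ∧
    Asymptotics.IsLittleO Filter.atTop
      (fun n : ℕ => NCSoliton.Psi κ n - NCSoliton.PsiAsym κ n)
      (fun n : ℕ => NCSoliton.besselSize κ n) ∧
    (κ.im ≠ 0 →
      Asymptotics.IsEquivalent Filter.atTop (NCSoliton.Phi κ) (NCSoliton.PhiAsym κ) ∧
      Asymptotics.IsEquivalent Filter.atTop (NCSoliton.Psi κ) (NCSoliton.PsiAsym κ)) :=
  NCSoliton.isLittleO_and_isEquivalent_asym κ hκ
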